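/- A discounted Markov decision process (DMDP) consists of a finite non-empty set of states $\mathcal S$, a finite non-empty set of actions $\mathcal A_s$ for each state $s$, a transition matrix $P$ whose rows are indexed by the state-action pairs $\mathcal A=\{(s,a): s\in\mathcal S, a\in\mathcal A_s\}$ and are probability distributions $p_a(s)$ on $\mathcal S$, rewards $r_a(s)\in[0,1]$, and a discount factor $\gamma\in[0,1)$. Let $A_{\mathrm{tot}}=|\mathcal A|$, and let $\mathrm{nnz}(P)$ be the number of non-zero entries of $P$. A policy $\pi$ maps each state $s$ to an action $\pi(s)\in\mathcal A_s$; its value is $v^\pi(s_0)=\mathbb E[\sum_{t\ge 0}\gamma^t r_{\pi(s_t)}(s_t)]$, where $s_{t+1}$ is drawn from $p_{\pi(s_t)}(s_t)$, and $v^\star(s_0)=\max_\pi v^\pi(s_0)$. The policy $\pi$ is $\epsilon$-optimal if $v^\pi(s)\ge v^\star(s)-\epsilon$ for all $s$, and $v\in\mathbb R^{\mathcal S}$ is a vector of $\epsilon$-optimal values if $\|v-v^\star\|_\infty\le\epsilon$. Theorem 1.2. There are a randomized algorithm, that is, one fixed program for a real-number random access machine (unit-cost arithmetic and comparisons on reals,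 without rounding; addition, subtraction, halving and comparison of natural numbers used as indices; conversion of natural numbers to reals; unit-cost uniform random draws from $[0,1]$), and constants $C$ and $k$ such that the following holds for every DMDP, every $\epsilon>0$ and every $\delta\in(0,1)$. Given $\gamma,\epsilon,\delta$, the rewards, and $P$ as the list of its non-zero entries ordered by rows, with the rows of each state listed consecutively, the algorithm always halts within $$C\,\bigl(\mathrm{nnz}(P)+A_{\mathrm{tot}}(1-\gamma)^{-2}\bigr)\,\log^k\bigl(2+A_{\mathrm{tot}}+\epsilon^{-1}+(1-\gamma)^{-1}+\delta^{-1}\bigr)$$ operations, and with probability at least $1-\delta$ it outputs both an $\epsilon$-optimal policy and $\epsilon$-optimal values. -/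

import Mathlib

open MeasureTheory

/-! ### Discounted Markov decision processes -/

/-- A tabular discounted Markov decision process with state set `S` and action set `A s` at each
state `s`: `P (s, a)` is the distribution of the next state when action `a` is taken at state `s`,
`r (s, a)` is the reward and `γ` is the discount factor. -/
structure DMDP (S : Type) [Fintype S] (A : S → Type) where
  P : (Σ s, A s) → S → ℝ
  P_nonneg : ∀ q s', 0 ≤ P q s'
  P_sum : ∀ q, ∑ s', P q s' = 1
  r : (Σ s, A s) → ℝ
  r_nonneg : ∀ q, 0 ≤ r q
  r_le_one : ∀ q, r q ≤ 1
  γ : ℝ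
  γ_nonneg : 0 ≤ γ
  γ_lt_one : γ < 1

namespace DMDP

variable {S : Type} [Fintype S] {A : S → Type} [∀ s, Fintype (A s)]

/-- A (deterministic) policy chooses an action at each state. -/
abbrev Policy (_M : DMDP S A) : Type := ∀ s, A s

/-- The law of the state `s_t` in round `t`, when the first state is `s₀` and the agent follows the
policy `π`. -/
noncomputable def stateLaw (M : DMDP S A) (π : M.Policy) (s₀ : S) : ℕ → S → ℝ
  | 0 => open Classical in fun s => if s = s₀ then 1 else 0
  | t + 1 => fun s' => ∑ s, stateLaw M π s₀ t s * M.P ⟨s, π s⟩ s'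

/-- The expected reward that `π` collects in round `t` when started from `s₀`. -/
noncomputable def expectedReward (M : DMDP S A) (π : M.Policy) (s₀ : S) (t : ℕ) : ℝ :=
  ∑ s, M.stateLaw π s₀ t s * M.r ⟨s, π s⟩

/-- The expected discounted reward of `π` from `s₀`; the series converges absolutely, as its terms
lie between `0` and `γ ^ t`. -/
noncomputable def value (M : DMDP S A) (π : M.Policy) (s₀ : S) : ℝ :=
  ∑' t : ℕ, M.γ ^ t * M.expectedReward π s₀ t

/-- The optimal value: the maximum expected discounted reward of any policy, for each initial
state (a maximum over finitely many policies). -/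
noncomputable def optValue (M : DMDP S A) (s₀ : S) : ℝ :=
  ⨆ π : M.Policy, M.value π s₀

/-- `π` is an `ε`-optimal policy: from every initial state, its expected discounted reward is at
least the optimal value minus `ε`. -/
def IsEpsOptimalPolicy (M : DMDP S A) (ε : ℝ) (π : M.Policy) : Prop :=
  ∀ s₀, M.optValue s₀ - ε ≤ M.value π s₀

/-- `v` is an `ε`-optimal value vector: `‖v - v⋆‖ ≤ ε` in the sup norm of `S → ℝ`. -/
def IsEpsOptimalValue (M : DMDP S A) (ε : ℝ) (v : S → ℝ) : Prop :=
  ‖v - M.optValue‖ ≤ ε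

/-- The number of states. -/
noncomputable def numStates (_M : DMDP S A) : ℕ := Fintype.card S

/-- The number `A_tot` of state-action pairs. -/
noncomputable def numPairs (_M : DMDP S A) : ℕ := Fintype.card (Σ s, A s)

/-- The positions of the nonzero entries of the transition matrix. -/
abbrev Nonzeros (M : DMDP S A) : Type := {q : (Σ s, A s) × S // M.P q.1 q.2 ≠ 0}

/-- The number `nnz(P)` of nonzero entries of the transition matrix. -/
noncomputable def nnz (M : DMDP S A) : ℕ := Nat.card M.Nonzeros

end DMDP

/-! ### A randomized real random access machine

The memory consists of arrays of natural numbers (used for indices) and arrays of real numbers. An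
array is named by a number that is fixed in the program, its cells are addressed by computed natural
numbers. The unit-cost operations are: addition, truncated subtraction and halving of natural
numbers, the four arithmetic operations on reals, conversion of a natural number to a real,
comparisons, reading and writing a memory cell, and drawing a uniformly random number in `[0, 1]`.
There is no rounding of reals to integers. A program is a finite piece of syntax. -/

namespace RealRAM

/-- A configuration of the memory; `draws` counts the random numbers drawn so far. -/
structure State where
  nat : ℕ → ℕ → ℕ
  real : ℕ → ℕ → ℝ
  draws : ℕ

/-- Expressions for natural numbers; `get a i` reads cell `i` of array `a`. -/
inductive NExp where
  | lit (k : ℕ)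
  | get (a : ℕ) (i : NExp)
  | add (e f : NExp)
  | sub (e f : NExp)
  | half (e : NExp)

/-- Expressions for real numbers; `get a i` reads cell `i` of array `a`. -/
inductive RExp where
  | ofNat (e : NExp)
  | get (a : ℕ) (i : NExp)
  | add (e f : RExp)
  | sub (e f : RExp)
  | mul (e f : RExp)
  | div (e f : RExp)

/-- Tests. -/
inductive Test where
  | natLe (e f : NExp)
  | realLe (e f : RExp)
  | neg (b : Test)
  | conj (b c : Test)

/-- Programs: `setNat a i e` and `setReal a i e` store the value of `e` in cell `i` of array `a`,
and `draw a i` stores a fresh uniformly random number of `[0, 1]` there. -/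
inductive Prog where
  | skip
  | setNat (a : ℕ) (i : NExp) (e : NExp)
  | setReal (a : ℕ) (i : NExp) (e : RExp)
  | draw (a : ℕ) (i : NExp)
  | seq (p q : Prog)
  | ite (b : Test) (p q : Prog)
  | loop (b : Test) (p : Prog)

namespace NExp

def eval (σ : State) : NExp → ℕ
  | lit k => k
  | get a i => σ.nat a (i.eval σ)
  | add e f => e.eval σ + f.eval σ
  | sub e f => e.eval σ - f.eval σ
  | half e => e.eval σ / 2

/-- The number of operations in an expression. -/
def cost : NExp → ℕ
  | lit _ => 1
  | get _ i => i.cost + 1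
  | add e f => e.cost + f.cost + 1
  | sub e f => e.cost + f.cost + 1
  | half e => e.cost + 1

end NExp

namespace RExp

/-- The value of an expression; a division by zero gives `0`. -/
noncomputable def eval (σ : State) : RExp → ℝ
  | ofNat e => (e.eval σ : ℝ)
  | get a i => σ.real a (i.eval σ)
  | add e f => e.eval σ + f.eval σ
  | sub e f => e.eval σ - f.eval σ
  | mul e f => e.eval σ * f.eval σ
  | div e f => e.eval σ / f.eval σ

/-- The number of operations in an expression. -/
def cost : RExp → ℕ
  | ofNat e => e.cost + 1
  | get _ i => i.cost + 1
  | add e f => e.cost + f.cost + 1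
  | sub e f => e.cost + f.cost + 1
  | mul e f => e.cost + f.cost + 1
  | div e f => e.cost + f.cost + 1

end RExp

namespace Test

/-- The test succeeds in the given memory. -/
def Holds (σ : State) : Test → Prop
  | natLe e f => e.eval σ ≤ f.eval σ
  | realLe e f => e.eval σ ≤ f.eval σ
  | neg b => ¬ b.Holds σ
  | conj b c => b.Holds σ ∧ c.Holds σ

/-- The number of operations in a test. -/
def cost : Test → ℕ
  | natLe e f => e.cost + f.cost + 1
  | realLe e f => e.cost + f.cost + 1
  | neg b => b.cost + 1
  | conj b c => b.cost + c.cost + 1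

end Test

namespace State

/-- Overwrite cell `i` of the array `a` of natural numbers. -/
def writeNat (σ : State) (a i x : ℕ) : State :=
  { σ with nat := Function.update σ.nat a (Function.update (σ.nat a) i x) }

/-- Overwrite cell `i` of the array `a` of real numbers. -/
noncomputable def writeReal (σ : State) (a i : ℕ) (x : ℝ) : State :=
  { σ with real := Function.update σ.real a (Function.update (σ.real a) i x) }

end State

/-- The outcomes of all random draws, in the order in which a run uses them. -/
abbrev Tape : Type := ℕ → unitInterval

/-- The draws are independent and uniformly distributed on `[0, 1]`. -/
noncomputable def tapeMeasure : Measure Tape :=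
  Measure.infinitePi fun _ : ℕ => (volume : Measure unitInterval)

/-- `Exec ω p σ t σ'`: started with memory `σ`, and with random draws `ω`, the program `p` halts
after `t` operations with memory `σ'`. -/
inductive Exec (ω : Tape) : Prog → State → ℕ → State → Prop
  | skip (σ : State) : Exec ω Prog.skip σ 1 σ
  | setNat (a : ℕ) (i e : NExp) (σ : State) :
      Exec ω (Prog.setNat a i e) σ (i.cost + e.cost + 1) (σ.writeNat a (i.eval σ) (e.eval σ))
  | setReal (a : ℕ) (i : NExp) (e : RExp) (σ : State) :
      Exec ω (Prog.setReal a i e) σ (i.cost + e.cost + 1) (σ.writeReal a (i.eval σ) (e.eval σ))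
  | draw (a : ℕ) (i : NExp) (σ : State) :
      Exec ω (Prog.draw a i) σ (i.cost + 1)
        { σ.writeReal a (i.eval σ) (ω σ.draws : ℝ) with draws := σ.draws + 1 }
  | seq {p q : Prog} {σ σ' σ'' : State} {t t' : ℕ} :
      Exec ω p σ t σ' → Exec ω q σ' t' σ'' → Exec ω (Prog.seq p q) σ (t + t') σ''
  | ite_true {b : Test} {p q : Prog} {σ σ' : State} {t : ℕ} :
      b.Holds σ → Exec ω p σ t σ' → Exec ω (Prog.ite b p q) σ (b.cost + t) σ'
  | ite_false {b : Test} {p q : Prog} {σ σ' : State} {t : ℕ} :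
      ¬ b.Holds σ → Exec ω q σ t σ' → Exec ω (Prog.ite b p q) σ (b.cost + t) σ'
  | loop_true {b : Test} {p : Prog} {σ σ' σ'' : State} {t t' : ℕ} :
      b.Holds σ → Exec ω p σ t σ' → Exec ω (Prog.loop b p) σ' t' σ'' →
      Exec ω (Prog.loop b p) σ (b.cost + t + t') σ''
  | loop_false {b : Test} {p : Prog} {σ : State} :
      ¬ b.Holds σ → Exec ω (Prog.loop b p) σ b.cost σ

end RealRAM

/-! ### Input and output of an algorithm in the offline setting -/

namespace DMDP

variable {S : Type} [Fintype S] {A : S → Type} [∀ s, Fintype (A s)]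

/-- A numbering, from `0` on, of the states, the state-action pairs and the nonzero entries of the
transition matrix, in which the pairs are grouped by their state, and the entries by their row. -/
structure Numbering (M : DMDP S A) where
  state : Fin M.numStates ≃ S
  pair : Fin M.numPairs ≃ Σ s, A s
  entry : Fin M.nnz ≃ M.Nonzeros
  pair_sorted : Monotone fun j => state.symm (pair j).1
  entry_sorted : Monotone fun e => pair.symm (entry e).1.1

namespace Numbering

variable {M : DMDP S A}

/-- The initial memory of the machine. The transition matrix is given as the list of its nonzero
entries with their rows and columns. All cells that do not hold the input are `0`.
* natural-number array `0`: the numbers of states, of state-action pairs and of nonzero entries;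
* natural-number array `1`: the state of each state-action pair;
* natural-number arrays `2` and `3`: the row (a pair) and the column (a state) of each nonzero entry;
* real array `0`: `γ`, `ε` and `δ`;
* real array `1`: the reward of each state-action pair;
* real array `2`: the nonzero entries themselves. -/
noncomputable def input (I : M.Numbering) (ε δ : ℝ) : RealRAM.State where
  nat
    | 0, 0 => M.numStates
    | 0, 1 => M.numPairs
    | 0, 2 => M.nnz
    | 1, j => if h : j < M.numPairs then I.state.symm (I.pair ⟨j, h⟩).1 else 0
    | 2, e => if h : e < M.nnz then I.pair.symm (I.entry ⟨e, h⟩).1.1 else 0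
    | 3, e => if h : e < M.nnz then I.state.symm (I.entry ⟨e, h⟩).1.2 else 0
    | _, _ => 0
  real
    | 0, 0 => M.γ
    | 0, 1 => ε
    | 0, 2 => δ
    | 1, j => if h : j < M.numPairs then M.r (I.pair ⟨j, h⟩) else 0
    | 2, e => if h : e < M.nnz then M.P (I.entry ⟨e, h⟩).1.1 (I.entry ⟨e, h⟩).1.2 else 0
    | _, _ => 0
  draws := 0

/-- The final memory holds an `ε`-optimal policy, in natural-number array `4` (for each state, the
number of the state-action pair that is chosen there), and `ε`-optimal values, in real array `3`. -/
def IsEpsOptimalOutput (I : M.Numbering) (ε : ℝ) (σ : RealRAM.State) : Prop :=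
  (∃ π : M.Policy, M.IsEpsOptimalPolicy ε π ∧
    ∀ s, σ.nat 4 (I.state.symm s) = I.pair.symm ⟨s, π s⟩) ∧
  M.IsEpsOptimalValue ε fun s => σ.real 3 (I.state.symm s)

end Numbering

end DMDP

/-!
The algorithm is truncated variance-reduced value iteration. With `N ≈ (1 - γ)⁻¹`, an epoch starts
from values that are accurate to `N * w`, computes their expectations at the next state exactly for
each pair, at the cost of one pass over the entries of `P`, and then performs about `N ^ 2` rounds
of value iteration, up to logarithmic factors. A round changes no value by more than a width `h`,
which is smaller than `w` by a factor of the order of `N` and a logarithm, and it updates the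
expectation of each pair by the change of the value of a single sampled successor. The error of such
an estimate is therefore a martingale with increments of size `h`, and with high probability it
stays of the order of `w` over the whole epoch. An exact Bellman step contracts the error of the
values by `γ`, so that estimates of this accuracy, and the truncation, still allow the rounds of one
epoch to halve the error. Logarithmically many epochs suffice, and a policy that is greedy for the
final values is nearly optimal.

A successor is sampled by a binary search in the partial sums of the entries of `P`.
-/

/-! ### A program logic for the random access machine -/

namespace RealRAM

namespace State

variable (σ : State)

theorem writeNat_nat_of_ne {a b : ℕ} (h : b ≠ a) (i x : ℕ) :
    (σ.writeNat a i x).nat b = σ.nat b := by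
  simp only [writeNat, Function.update_of_ne h]

@[simp] theorem writeNat_nat_apply (a i x b j : ℕ) :
    (σ.writeNat a i x).nat b j = if b = a then (if j = i then x else σ.nat a j) else σ.nat b j := by
  simp only [writeNat, Function.update_apply]
  split_ifs <;> simp_all

@[simp] theorem writeNat_real (a i x : ℕ) : (σ.writeNat a i x).real = σ.real := rfl

@[simp] theorem writeNat_draws (a i x : ℕ) : (σ.writeNat a i x).draws = σ.draws := rfl

theorem writeReal_real_of_ne {a b : ℕ} (h : b ≠ a) (i : ℕ) (x : ℝ) :
    (σ.writeReal a i x).real b = σ.real b := by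
  simp only [writeReal, Function.update_of_ne h]

@[simp] theorem writeReal_real_apply (a i : ℕ) (x : ℝ) (b j : ℕ) :
    (σ.writeReal a i x).real b j =
      if b = a then (if j = i then x else σ.real a j) else σ.real b j := by
  simp only [writeReal, Function.update_apply]
  split_ifs <;> simp_all

@[simp] theorem writeReal_nat (a i : ℕ) (x : ℝ) : (σ.writeReal a i x).nat = σ.nat := rfl

@[simp] theorem writeReal_draws (a i : ℕ) (x : ℝ) : (σ.writeReal a i x).draws = σ.draws := rfl

@[simp] theorem writeReal_self (a i : ℕ) : σ.writeReal a i (σ.real a i) = σ := by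
  simp only [writeReal, Function.update_eq_self]

end State

namespace Prog

/-- Whether the program contains a write to the array `a` of natural numbers. -/
@[simp] def writesNat (a : ℕ) : Prog → Bool
  | skip | setReal _ _ _ | draw _ _ => false
  | setNat b _ _ => b == a
  | seq p q | ite _ p q => p.writesNat a || q.writesNat a
  | loop _ p => p.writesNat a

/-- Whether the program contains a write to the array `a` of real numbers. -/
@[simp] def writesReal (a : ℕ) : Prog → Bool
  | skip | setNat _ _ _ => false
  | setReal b _ _ | draw b _ => b == a
  | seq p q | ite _ p q => p.writesReal a || q.writesReal a
  | loop _ p => p.writesReal a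

/-- Whether the program contains a random draw. -/
@[simp] def draws : Prog → Bool
  | skip | setNat _ _ _ | setReal _ _ _ => false
  | draw _ _ => true
  | seq p q | ite _ p q => p.draws || q.draws
  | loop _ p => p.draws

/-- An upper bound for the running time of a loop-free program; a loop counts for nothing. -/
def cost : Prog → ℕ
  | skip => 1
  | setNat _ i e => i.cost + e.cost + 1
  | setReal _ i e => i.cost + e.cost + 1
  | draw _ i => i.cost + 1
  | seq p q => p.cost + q.cost
  | ite b p q => b.cost + (p.cost + q.cost)
  | loop _ _ => 0

/-- The weakest precondition of a loop-free program; it is false for a program with a loop. -/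
def wp (ω : Tape) : Prog → (State → Prop) → State → Prop
  | skip, Q, σ => Q σ
  | setNat a i e, Q, σ => Q (σ.writeNat a (i.eval σ) (e.eval σ))
  | setReal a i e, Q, σ => Q (σ.writeReal a (i.eval σ) (e.eval σ))
  | draw a i, Q, σ => Q { σ.writeReal a (i.eval σ) (ω σ.draws : ℝ) with draws := σ.draws + 1 }
  | seq p q, Q, σ => p.wp ω (q.wp ω Q) σ
  | ite b p q, Q, σ => (b.Holds σ → p.wp ω Q σ) ∧ (¬ b.Holds σ → q.wp ω Q σ)
  | loop _ _, _, _ => False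

/-- Lowers a real cell to the value of `e` if it is larger. -/
def capReal (a : ℕ) (i : NExp) (e : RExp) : Prog :=
  ite (.realLe e (.get a i)) (setReal a i e) skip

/-- Raises a real cell to the value of `e` if it is smaller. -/
def raiseReal (a : ℕ) (i : NExp) (e : RExp) : Prog :=
  ite (.realLe (.get a i) e) (setReal a i e) skip

variable {ω : Tape} {a : ℕ} {i : NExp} {e : RExp} {Q : State → Prop} {σ : State}

theorem wp_capReal : (capReal a i e).wp ω Q σ ↔
    Q (σ.writeReal a (i.eval σ) (min (σ.real a (i.eval σ)) (e.eval σ))) := by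
  rcases le_total (e.eval σ) (σ.real a (i.eval σ)) with h | h
  · simp +contextual [capReal, wp, Test.Holds, RExp.eval, h]
  · rcases h.eq_or_lt with h' | h'
    · simp [capReal, wp, Test.Holds, RExp.eval, ← h']
    · simp [capReal, wp, Test.Holds, RExp.eval, h, h']

theorem wp_raiseReal : (raiseReal a i e).wp ω Q σ ↔
    Q (σ.writeReal a (i.eval σ) (max (σ.real a (i.eval σ)) (e.eval σ))) := by
  rcases le_total (σ.real a (i.eval σ)) (e.eval σ) with h | h
  · simp +contextual [raiseReal, wp, Test.Holds, RExp.eval, h]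
  · rcases h.eq_or_lt with h' | h'
    · simp [raiseReal, wp, Test.Holds, RExp.eval, h']
    · simp [raiseReal, wp, Test.Holds, RExp.eval, h, h']

end Prog

/-- The memories `σ` and `σ'` differ at most in what the program `p` may write. -/
structure Frame (p : Prog) (σ σ' : State) : Prop where
  nat : ∀ a, p.writesNat a = false → σ'.nat a = σ.nat a
  real : ∀ a, p.writesReal a = false → σ'.real a = σ.real a
  draws : p.draws = false → σ'.draws = σ.draws

variable {ω : Tape} {b : Test} {p q : Prog} {σ σ' σ'' : State} {t T T' : ℕ} {Q R : State → Prop}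

theorem Frame.refl (p : Prog) (σ : State) : Frame p σ σ :=
  ⟨fun _ _ => rfl, fun _ _ => rfl, fun _ => rfl⟩

theorem Frame.trans (h : Frame p σ σ') (h' : Frame p σ' σ'') : Frame p σ σ'' :=
  ⟨fun a ha => (h'.nat a ha).trans (h.nat a ha), fun a ha => (h'.real a ha).trans (h.real a ha),
    fun hp => (h'.draws hp).trans (h.draws hp)⟩

theorem Frame.mono (h : Frame p σ σ') (hn : ∀ a, q.writesNat a = false → p.writesNat a = false)
    (hr : ∀ a, q.writesReal a = false → p.writesReal a = false)
    (hd : q.draws = false → p.draws = false) : Frame q σ σ' :=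
  ⟨fun a ha => h.nat a (hn a ha), fun a ha => h.real a (hr a ha), fun hq => h.draws (hd hq)⟩

theorem Exec.frame (h : Exec ω p σ t σ') : Frame p σ σ' := by
  induction h with
  | skip | loop_false => exact ⟨fun _ _ => rfl, fun _ _ => rfl, fun _ => rfl⟩
  | setNat b _ _ σ =>
    refine ⟨fun a ha => σ.writeNat_nat_of_ne (Ne.symm ?_) _ _, fun _ _ => rfl, fun _ => rfl⟩
    simpa using ha
  | setReal b _ _ σ =>
    refine ⟨fun _ _ => rfl, fun a ha => σ.writeReal_real_of_ne (Ne.symm ?_) _ _, fun _ => rfl⟩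
    simpa using ha
  | draw b _ σ =>
    refine ⟨fun _ _ => rfl, fun a ha => σ.writeReal_real_of_ne (Ne.symm ?_) _ _, by simp⟩
    simpa using ha
  | seq _ _ h₁ h₂ | loop_true _ _ _ h₁ h₂ =>
    constructor <;> simp +contextual [h₁.nat, h₁.real, h₁.draws, h₂.nat, h₂.real, h₂.draws]
  | ite_true _ _ h₁ | ite_false _ _ h₁ =>
    constructor <;> simp +contextual [h₁.nat, h₁.real, h₁.draws]

/-- Started with memory `σ`, the program `p` halts within `T` operations, with a memory that
satisfies `Q`. -/
def Runs (ω : Tape) (p : Prog) (σ : State) (T : ℕ) (Q : State → Prop) : Prop :=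
  ∃ t σ', Exec ω p σ t σ' ∧ t ≤ T ∧ Q σ'

namespace Runs

theorem mono (h : Runs ω p σ T Q) (hT : T ≤ T') (hQ : ∀ σ', Frame p σ σ' → Q σ' → R σ') :
    Runs ω p σ T' R := by
  obtain ⟨t, σ', he, ht, hQσ⟩ := h
  exact ⟨t, σ', he, ht.trans hT, hQ σ' he.frame hQσ⟩

theorem of_le (h : Runs ω p σ T Q) (hT : T ≤ T') : Runs ω p σ T' Q :=
  h.mono hT fun _ _ => id

theorem seq (h : Runs ω p σ T R) (hq : ∀ σ', Frame p σ σ' → R σ' → Runs ω q σ' T' Q) :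
    Runs ω (p.seq q) σ (T + T') Q := by
  obtain ⟨t, σ', he, ht, hR⟩ := h
  obtain ⟨t', σ'', he', ht', hQ⟩ := hq σ' he.frame hR
  exact ⟨t + t', σ'', .seq he he', by lia, hQ⟩

theorem of_wp {p : Prog} {σ : State} {Q : State → Prop} (h : p.wp ω Q σ)
    (hT : p.cost ≤ T := by decide) : Runs ω p σ T Q := by
  suffices H : Runs ω p σ p.cost Q from H.of_le hT
  clear hT
  induction p generalizing σ Q with
  | skip => exact ⟨_, _, .skip σ, le_rfl, h⟩
  | setNat a i e => exact ⟨_, _, .setNat a i e σ, le_rfl, h⟩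
  | setReal a i e => exact ⟨_, _, .setReal a i e σ, le_rfl, h⟩
  | draw a i => exact ⟨_, _, .draw a i σ, le_rfl, h⟩
  | seq p q hp hq => exact (hp h).seq fun _ _ => hq
  | ite b p q hp hq =>
    by_cases hb : b.Holds σ
    · obtain ⟨t, σ', he, ht, hQ⟩ := hp (h.1 hb)
      exact ⟨_, σ', .ite_true hb he, by simp only [Prog.cost]; lia, hQ⟩
    · obtain ⟨t, σ', he, ht, hQ⟩ := hq (h.2 hb)
      exact ⟨_, σ', .ite_false hb he, by simp only [Prog.cost]; lia, hQ⟩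
  | loop b p => exact h.elim

theorem loop_of_measure (Inv : ℕ → State → Prop)
    (hstep : ∀ k σ', Frame p σ σ' → Inv k σ' → b.Holds σ' → ∃ k' < k, Runs ω p σ' T (Inv k'))
    (hdone : ∀ k σ', Frame p σ σ' → Inv k σ' → ¬ b.Holds σ' → Q σ') (k : ℕ) (hσ : Inv k σ)
    (hT : b.cost + T ≤ T') : Runs ω (Prog.loop b p) σ ((k + 1) * T') Q := by
  suffices H : ∀ k σ', Frame p σ σ' → Inv k σ' →
      Runs ω (Prog.loop b p) σ' ((k + 1) * T') Q from H k σ (Frame.refl p σ) hσ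
  intro k
  induction k using Nat.strong_induction_on with
  | _ k ih =>
    intro σ' hF hσ'
    by_cases hb : b.Holds σ'
    · obtain ⟨k', hk', t, σ'', he, ht, hσ''⟩ := hstep k σ' hF hσ' hb
      obtain ⟨t', τ, he', ht', hQ⟩ := ih k' hk' σ'' (hF.trans he.frame) hσ''
      exact ⟨_, τ, .loop_true hb he he', by nlinarith, hQ⟩
    · exact ⟨_, σ', .loop_false hb, by nlinarith, hdone k σ' hF hσ' hb⟩

theorem loop (Inv : ℕ → State → Prop) (n : ℕ) (h₀ : Inv 0 σ)
    (htest : ∀ i ≤ n, ∀ σ', Frame p σ σ' → Inv i σ' → (b.Holds σ' ↔ i < n))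
    (hbody : ∀ i < n, ∀ σ', Frame p σ σ' → Inv i σ' → Runs ω p σ' T (Inv (i + 1)))
    (hT : b.cost + T ≤ T') : Runs ω (Prog.loop b p) σ ((n + 1) * T') (Inv n) := by
  refine loop_of_measure (fun k σ => ∃ i, i + k = n ∧ Inv i σ) ?_ ?_ n ⟨0, by lia, h₀⟩ hT
  · rintro k σ' hF ⟨i, hi, hσ'⟩ hb
    have hlt : i < n := (htest i (by lia) σ' hF hσ').1 hb
    exact ⟨k - 1, by lia, (hbody i hlt σ' hF hσ').mono le_rfl fun _ _ h => ⟨i + 1, by lia, h⟩⟩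
  · rintro k σ' hF ⟨i, hi, hσ'⟩ hb
    have hle : ¬ i < n := fun hlt => hb ((htest i (by lia) σ' hF hσ').2 hlt)
    obtain rfl : i = n := by lia
    exact hσ'

end Runs

/-- Runs `p` for the values `0, 1, …, n - 1` of the counter, which is held in cell `0` of the array
`c` of natural numbers. -/
def forLoop (c : ℕ) (n : RExp) (p : Prog) : Prog :=
  .seq (.setNat c (.lit 0) (.lit 0))
    (.loop (.neg (.realLe n (.ofNat (.get c (.lit 0)))))
      (.seq p (.setNat c (.lit 0) (.add (.get c (.lit 0)) (.lit 1)))))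

theorem Runs.forLoop {c : ℕ} {n : RExp} (Inv : ℕ → State → Prop) (k : ℕ)
    (hc : p.writesNat c = false)
    (hn : ∀ σ', Frame (RealRAM.forLoop c n p) σ σ' → n.eval σ' = k)
    (h₀ : Inv 0 (σ.writeNat c 0 0))
    (hbody : ∀ i < k, ∀ σ', Frame (RealRAM.forLoop c n p) σ σ' → Inv i σ' → σ'.nat c 0 = i →
      Runs ω p σ' T fun σ'' => Inv (i + 1) (σ''.writeNat c 0 (i + 1)))
    (hT : n.cost + T + 14 ≤ T') :
    Runs ω (RealRAM.forLoop c n p) σ ((k + 1) * T') (Inv k) := by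
  have hinit : Runs ω (Prog.setNat c (.lit 0) (.lit 0)) σ 3 fun σ' => Inv 0 σ' ∧ σ'.nat c 0 = 0 :=
    Runs.of_wp (by simpa [Prog.wp, NExp.eval] using h₀) le_rfl
  have hframe : ∀ {σ₁ σ₂}, Frame (Prog.setNat c (.lit 0) (.lit 0)) σ σ₁ →
      Frame (p.seq (.setNat c (.lit 0) (.add (.get c (.lit 0)) (.lit 1)))) σ₁ σ₂ →
      Frame (RealRAM.forLoop c n p) σ σ₂ := fun h₁ h₂ => by
    refine (h₁.mono ?_ ?_ ?_).trans (h₂.mono ?_ ?_ ?_) <;> simp +contextual [RealRAM.forLoop]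
  refine (hinit.seq fun σ₁ hF₁ hσ₁ => Runs.loop (T := T + 6)
    (fun i σ => Inv i σ ∧ σ.nat c 0 = i) k hσ₁ ?_ ?_ le_rfl).mono ?_ fun _ _ h => h.1
  · rintro i - σ₂ hF₂ ⟨-, hi⟩
    simp [Test.Holds, hn σ₂ (hframe hF₁ hF₂), RExp.eval, NExp.eval, hi]
  · rintro i hi σ₂ hF₂ ⟨hσ₂, hci⟩
    refine (hbody i hi σ₂ (hframe hF₁ hF₂) hσ₂ hci).seq fun σ₃ hF₃ hσ₃ => Runs.of_wp ?_ le_rfl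
    have hc' : σ₃.nat c 0 = i := by rw [hF₃.nat c hc, hci]
    simpa [Prog.wp, NExp.eval, hc'] using hσ₃
  · simp only [Test.cost, RExp.cost, NExp.cost]
    nlinarith

end RealRAM

/-! ### Bellman equations -/

namespace DMDP

variable {S : Type} [Fintype S] {A : S → Type} (M : DMDP S A)

/-- The expected total reward of a state-action pair when the next state is worth `v`. -/
noncomputable def qValue (v : S → ℝ) (q : Σ s, A s) : ℝ := M.r q + M.γ * ∑ s', M.P q s' * v s'

theorem one_sub_γ_pos : 0 < 1 - M.γ := sub_pos.2 M.γ_lt_one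

theorem stateLaw_nonneg (π : M.Policy) (s₀ : S) (t : ℕ) (s : S) : 0 ≤ M.stateLaw π s₀ t s := by
  induction t generalizing s with
  | zero => simp only [stateLaw]; split_ifs <;> norm_num
  | succ t ih => exact Finset.sum_nonneg fun s' _ => mul_nonneg (ih s') (M.P_nonneg _ _)

theorem sum_stateLaw (π : M.Policy) (s₀ : S) (t : ℕ) : ∑ s, M.stateLaw π s₀ t s = 1 := by
  classical
  induction t with
  | zero => simp [stateLaw]
  | succ t ih =>
    simp only [stateLaw]
    rw [Finset.sum_comm]
    simp [← Finset.mul_sum, M.P_sum, ih]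

theorem stateLaw_succ_left (π : M.Policy) (s₀ : S) (t : ℕ) (s : S) :
    M.stateLaw π s₀ (t + 1) s = ∑ s₁, M.P ⟨s₀, π s₀⟩ s₁ * M.stateLaw π s₁ t s := by
  classical
  induction t generalizing s with
  | zero => simp [stateLaw]
  | succ t ih =>
    rw [stateLaw]
    simp_rw [ih, Finset.sum_mul]
    rw [Finset.sum_comm]
    simp_rw [stateLaw, Finset.mul_sum, mul_assoc]

theorem expectedReward_nonneg (π : M.Policy) (s₀ : S) (t : ℕ) : 0 ≤ M.expectedReward π s₀ t :=
  Finset.sum_nonneg fun s _ => mul_nonneg (M.stateLaw_nonneg π s₀ t s) (M.r_nonneg _)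

theorem expectedReward_le_one (π : M.Policy) (s₀ : S) (t : ℕ) : M.expectedReward π s₀ t ≤ 1 := by
  rw [← M.sum_stateLaw π s₀ t]
  exact Finset.sum_le_sum fun s _ =>
    mul_le_of_le_one_right (M.stateLaw_nonneg π s₀ t s) (M.r_le_one _)

theorem expectedReward_zero (π : M.Policy) (s : S) : M.expectedReward π s 0 = M.r ⟨s, π s⟩ := by
  classical
  simp [expectedReward, stateLaw]

theorem expectedReward_succ (π : M.Policy) (s : S) (t : ℕ) :
    M.expectedReward π s (t + 1) = ∑ s₁, M.P ⟨s, π s⟩ s₁ * M.expectedReward π s₁ t := by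
  simp only [expectedReward, stateLaw_succ_left, Finset.sum_mul, Finset.mul_sum]
  rw [Finset.sum_comm]
  simp only [mul_assoc]

theorem summable_value (π : M.Policy) (s₀ : S) :
    Summable fun t : ℕ => M.γ ^ t * M.expectedReward π s₀ t :=
  (summable_geometric_of_lt_one M.γ_nonneg M.γ_lt_one).of_nonneg_of_le
    (fun t => mul_nonneg (pow_nonneg M.γ_nonneg t) (M.expectedReward_nonneg π s₀ t))
    fun t => mul_le_of_le_one_right (pow_nonneg M.γ_nonneg t) (M.expectedReward_le_one π s₀ t)

theorem value_eq_qValue (π : M.Policy) (s : S) :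
    M.value π s = M.qValue (M.value π) ⟨s, π s⟩ := by
  have hsucc : ∀ t, M.γ ^ (t + 1) * M.expectedReward π s (t + 1) =
      M.γ * ∑ s₁, M.P ⟨s, π s⟩ s₁ * (M.γ ^ t * M.expectedReward π s₁ t) := fun t => by
    rw [expectedReward_succ, pow_succ', mul_assoc, Finset.mul_sum]
    simp only [mul_left_comm]
  rw [value, (M.summable_value π s).tsum_eq_zero_add, pow_zero, one_mul, expectedReward_zero]
  simp_rw [hsucc]
  rw [tsum_mul_left, Summable.tsum_finsetSum fun s₁ _ => (M.summable_value π s₁).mul_left _]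
  simp_rw [tsum_mul_left]
  rfl

theorem qValue_sub_le {v w : S → ℝ} {c : ℝ} (h : ∀ s, v s - w s ≤ c) (q : Σ s, A s) :
    M.qValue v q - M.qValue w q ≤ M.γ * c := by
  have havg : ∑ s', M.P q s' * (v s' - w s') ≤ c := by
    calc _ ≤ ∑ s', M.P q s' * c := Finset.sum_le_sum fun s' _ =>
          mul_le_mul_of_nonneg_left (h s') (M.P_nonneg _ _)
      _ = c := by rw [← Finset.sum_mul, M.P_sum, one_mul]
  calc M.qValue v q - M.qValue w q = M.γ * ∑ s', M.P q s' * (v s' - w s') := by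
        simp only [qValue, mul_sub, Finset.sum_sub_distrib]; ring
    _ ≤ M.γ * c := mul_le_mul_of_nonneg_left havg M.γ_nonneg

/- A maximum principle: at a state where `v - w` is largest, one step of `π` shrinks the difference
by the factor `γ`. -/
theorem sub_le_of_sub_le_add_qValue_sub {v w : S → ℝ} {c : ℝ} (π : M.Policy)
    (h : ∀ s, v s - w s ≤ c + (M.qValue v ⟨s, π s⟩ - M.qValue w ⟨s, π s⟩)) (s : S) :
    v s - w s ≤ c / (1 - M.γ) := by
  obtain ⟨m, -, hm⟩ := Finset.exists_max_image Finset.univ (fun s => v s - w s)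
    ⟨s, Finset.mem_univ s⟩
  have hmax : ∀ s, v s - w s ≤ v m - w m := fun s => hm s (Finset.mem_univ s)
  refine (hmax s).trans ?_
  rw [le_div_iff₀ M.one_sub_γ_pos]
  linarith [h m, M.qValue_sub_le hmax ⟨m, π m⟩]

section Optimality

variable [∀ s, Finite (A s)]

/-- The Bellman optimality operator. -/
noncomputable def bellman (v : S → ℝ) (s : S) : ℝ := ⨆ a : A s, M.qValue v ⟨s, a⟩

theorem qValue_le_bellman (v : S → ℝ) (s : S) (a : A s) : M.qValue v ⟨s, a⟩ ≤ M.bellman v s :=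
  le_ciSup (f := fun a => M.qValue v ⟨s, a⟩) (Set.finite_range _).bddAbove a

variable [∀ s, Nonempty (A s)]

theorem exists_policy_qValue_eq_bellman (v : S → ℝ) :
    ∃ π : M.Policy, ∀ s, M.qValue v ⟨s, π s⟩ = M.bellman v s := by
  choose π hπ using fun s => exists_eq_ciSup_of_finite (f := fun a : A s => M.qValue v ⟨s, a⟩)
  exact ⟨π, hπ⟩

theorem bellman_sub_le {v w : S → ℝ} {c : ℝ} (h : ∀ s, v s - w s ≤ c) (s : S) :
    M.bellman v s - M.bellman w s ≤ M.γ * c := by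
  obtain ⟨π, hπ⟩ := M.exists_policy_qValue_eq_bellman v
  linarith [hπ s, M.qValue_le_bellman w s (π s), M.qValue_sub_le h ⟨s, π s⟩]

theorem contractingWith_bellman : ContractingWith M.γ.toNNReal M.bellman := by
  refine ⟨by simpa using M.γ_lt_one, LipschitzWith.of_dist_le_mul fun v w => ?_⟩
  have hsub : ∀ v w : S → ℝ, ∀ s, v s - w s ≤ dist v w := fun v w s =>
    (le_abs_self _).trans (dist_le_pi_dist v w s)
  refine (dist_pi_le_iff (by positivity)).2 fun s => ?_
  rw [Real.dist_eq, Real.coe_toNNReal _ M.γ_nonneg, abs_sub_le_iff]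
  exact ⟨M.bellman_sub_le (hsub v w) s, dist_comm v w ▸ M.bellman_sub_le (hsub w v) s⟩

theorem optValue_eq_of_bellman_eq {u : S → ℝ} (hu : M.bellman u = u) : M.optValue = u := by
  obtain ⟨π, hπ⟩ := M.exists_policy_qValue_eq_bellman u
  have : Nonempty M.Policy := ⟨π⟩
  have hle : ∀ π' s, M.value π' s ≤ u s := fun π' s => by
    have := M.sub_le_of_sub_le_add_qValue_sub (v := M.value π') (w := u) (c := 0) π'
      (fun s => by
        rw [← M.value_eq_qValue]
        linarith [M.qValue_le_bellman u s (π' s), congrFun hu s]) s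
    rw [zero_div] at this
    linarith
  have hge : ∀ s, u s ≤ M.value π s := fun s => by
    have := M.sub_le_of_sub_le_add_qValue_sub (v := u) (w := M.value π) (c := 0) π
      (fun s => by rw [← M.value_eq_qValue, hπ, hu, zero_add]) s
    rw [zero_div] at this
    linarith
  exact funext fun s => le_antisymm (ciSup_le fun π' => hle π' s)
    ((hge s).trans (le_ciSup (f := fun π => M.value π s) (Set.finite_range _).bddAbove π))

theorem bellman_optValue : M.bellman M.optValue = M.optValue := by
  have hfix := M.contractingWith_bellman.fixedPoint_isFixedPt
  rw [M.optValue_eq_of_bellman_eq hfix]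
  exact hfix

theorem exists_policy_qValue_optValue_eq :
    ∃ π : M.Policy, ∀ s, M.qValue M.optValue ⟨s, π s⟩ = M.optValue s := by
  obtain ⟨π, hπ⟩ := M.exists_policy_qValue_eq_bellman M.optValue
  exact ⟨π, fun s => by rw [hπ, bellman_optValue]⟩

theorem qValue_optValue_le (s : S) (a : A s) : M.qValue M.optValue ⟨s, a⟩ ≤ M.optValue s :=
  (M.qValue_le_bellman _ s a).trans_eq (congrFun M.bellman_optValue s)

theorem optValue_nonneg (s : S) : 0 ≤ M.optValue s := by
  obtain ⟨π, hπ⟩ := M.exists_policy_qValue_optValue_eq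
  have := M.sub_le_of_sub_le_add_qValue_sub (v := 0) (w := M.optValue) (c := 0) π
    (fun s => by
      have h₀ : M.qValue 0 ⟨s, π s⟩ = M.r ⟨s, π s⟩ := by simp [qValue]
      rw [hπ, h₀, Pi.zero_apply]
      linarith [M.r_nonneg ⟨s, π s⟩]) s
  simpa using this

theorem optValue_le (s : S) : M.optValue s ≤ 1 / (1 - M.γ) := by
  obtain ⟨π, hπ⟩ := M.exists_policy_qValue_optValue_eq
  have := M.sub_le_of_sub_le_add_qValue_sub (v := M.optValue) (w := 0) (c := 1) π
    (fun s => by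
      have h₀ : M.qValue 0 ⟨s, π s⟩ = M.r ⟨s, π s⟩ := by simp [qValue]
      rw [hπ, h₀, Pi.zero_apply]
      linarith [M.r_le_one ⟨s, π s⟩]) s
  simpa using this

theorem isEpsOptimalPolicy_of_greedy {v : S → ℝ} {α ε : ℝ} (hv : ∀ s, |v s - M.optValue s| ≤ α)
    (hα : 2 * α ≤ ε * (1 - M.γ)) (π : M.Policy)
    (hπ : ∀ s a, M.qValue v ⟨s, a⟩ ≤ M.qValue v ⟨s, π s⟩) : M.IsEpsOptimalPolicy ε π := by
  obtain ⟨π', hπ'⟩ := M.exists_policy_qValue_optValue_eq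
  intro s
  have hstep : ∀ s, M.optValue s - M.value π s ≤
      2 * α + (M.qValue M.optValue ⟨s, π s⟩ - M.qValue (M.value π) ⟨s, π s⟩) := fun s => by
    have hα₀ : M.γ * α ≤ α :=
      mul_le_of_le_one_left ((abs_nonneg _).trans (hv s)) M.γ_lt_one.le
    have hopt := M.qValue_sub_le (fun s => (abs_sub_le_iff.1 (hv s)).2) ⟨s, π' s⟩
    have happrox := M.qValue_sub_le (fun s => (abs_sub_le_iff.1 (hv s)).1) ⟨s, π s⟩
    linarith [hπ s (π' s), hπ' s, M.value_eq_qValue π s]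
  have hgap := M.sub_le_of_sub_le_add_qValue_sub π hstep s
  linarith [(div_le_iff₀ M.one_sub_γ_pos).2 hα]

end Optimality

end DMDP

/-! ### Sums of subgaussian increments with fresh randomness -/

section Subgaussian

open ProbabilityTheory
open scoped NNReal

theorem hasSubgaussianMGF_mono {Ω : Type*} {_ : MeasurableSpace Ω} {μ : Measure Ω} {X : Ω → ℝ}
    {c c' : ℝ≥0} (h : HasSubgaussianMGF X c μ) (hc : c ≤ c') : HasSubgaussianMGF X c' μ :=
  ⟨h.integrable_exp_mul, fun t => (h.mgf_le t).trans (by gcongr)⟩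

theorem hasSubgaussianMGF_prod_add {Ω Ω' : Type*} {_ : MeasurableSpace Ω} {_ : MeasurableSpace Ω'}
    {μ : Measure Ω} {ν : Measure Ω'} [SFinite μ] [SFinite ν] {W : Ω → ℝ} {X : Ω → Ω' → ℝ}
    {c c' : ℝ≥0} (hWm : Measurable W) (hXm : Measurable (Function.uncurry X))
    (hW : HasSubgaussianMGF W c μ) (hX : ∀ ω, HasSubgaussianMGF (X ω) c' ν) :
    HasSubgaussianMGF (fun p : Ω × Ω' => W p.1 + X p.1 p.2) (c + c') (μ.prod ν) := by
  have hexp : ∀ t ω, ∫ u, Real.exp (t * (W ω + X ω u)) ∂ν =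
      Real.exp (t * W ω) * mgf (X ω) ν t := fun t ω => by
    simp_rw [mul_add, Real.exp_add, integral_const_mul, mgf]
  have hmeas : ∀ t, Measurable fun p : Ω × Ω' => Real.exp (t * (W p.1 + X p.1 p.2)) := fun t =>
    (((hWm.comp measurable_fst).add hXm).const_mul t).exp
  have hle : ∀ t ω, ∫ u, Real.exp (t * (W ω + X ω u)) ∂ν ≤
      Real.exp (t * W ω) * Real.exp (c' * t ^ 2 / 2) := fun t ω => by
    rw [hexp]
    exact mul_le_mul_of_nonneg_left ((hX ω).mgf_le t) (Real.exp_pos _).le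
  have hint : ∀ t, Integrable (fun p : Ω × Ω' => Real.exp (t * (W p.1 + X p.1 p.2)))
      (μ.prod ν) := by
    refine fun t => (integrable_prod_iff (hmeas t).aestronglyMeasurable).2
      ⟨.of_forall fun ω => ?_, ?_⟩
    · simp_rw [mul_add, Real.exp_add]
      exact ((hX ω).integrable_exp_mul t).const_mul _
    · simp_rw [Real.norm_of_nonneg (Real.exp_pos _).le]
      refine ((hW.integrable_exp_mul t).mul_const (Real.exp (c' * t ^ 2 / 2))).mono'
        (hmeas t).stronglyMeasurable.integral_prod_right.aestronglyMeasurable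
        (.of_forall fun ω => ?_)
      rw [Real.norm_of_nonneg (integral_nonneg fun _ => (Real.exp_pos _).le)]
      exact hle t ω
  refine ⟨hint, fun t => ?_⟩
  calc mgf (fun p : Ω × Ω' => W p.1 + X p.1 p.2) (μ.prod ν) t
      = ∫ ω, ∫ u, Real.exp (t * (W ω + X ω u)) ∂ν ∂μ := integral_prod _ (hint t)
    _ ≤ ∫ ω, Real.exp (t * W ω) * Real.exp (c' * t ^ 2 / 2) ∂μ :=
        integral_mono (hint t).integral_prod_left
          ((hW.integrable_exp_mul t).mul_const _) (hle t)
    _ = mgf W μ t * Real.exp (c' * t ^ 2 / 2) := integral_mul_const _ _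
    _ ≤ Real.exp (c * t ^ 2 / 2) * Real.exp (c' * t ^ 2 / 2) := by gcongr; exact hW.mgf_le t
    _ = Real.exp (↑(c + c') * t ^ 2 / 2) := by rw [← Real.exp_add]; push_cast; ring_nf

theorem measure_le_abs_le_of_hasSubgaussianMGF {Ω : Type*} {_ : MeasurableSpace Ω} {μ : Measure Ω}
    [IsFiniteMeasure μ] {X : Ω → ℝ} {c : ℝ≥0} (h : HasSubgaussianMGF X c μ) {a : ℝ} (ha : 0 ≤ a) :
    μ {ω | a ≤ |X ω|} ≤ ENNReal.ofReal (2 * Real.exp (-a ^ 2 / (2 * c))) := by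
  have hsub : {ω | a ≤ |X ω|} ⊆ {ω | a ≤ X ω} ∪ {ω | a ≤ (-X) ω} := fun ω hω => by
    simpa [le_abs] using hω
  refine (measure_mono hsub).trans ((measure_union_le _ _).trans ?_)
  rw [two_mul, ENNReal.ofReal_add (Real.exp_pos _).le (Real.exp_pos _).le]
  gcongr
  · exact (ENNReal.le_ofReal_iff_toReal_le (measure_ne_top _ _) (Real.exp_pos _).le).2
      (h.measure_ge_le ha)
  · exact (ENNReal.le_ofReal_iff_toReal_le (measure_ne_top _ _) (Real.exp_pos _).le).2
      (h.neg.measure_ge_le ha)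

section Resampling

variable {ι : Type*} [DecidableEq ι] {Ω : ι → Type*} [∀ i, MeasurableSpace (Ω i)]
  (μ : ∀ i, Measure (Ω i))

/-- A process `W` whose increment in step `n` is `X n ω (ω (d n))`, a subgaussian function of the
coordinate `d n`, which neither `W n` nor the choice of this function depends on. -/
structure IsSubgaussianWalk (d : ℕ → ι) (c : ℝ≥0) (W : ℕ → (∀ i, Ω i) → ℝ)
    (X : ∀ n, (∀ i, Ω i) → Ω (d n) → ℝ) : Prop where
  zero : ∀ ω, W 0 ω = 0
  succ : ∀ n ω, W (n + 1) ω = W n ω + X n ω (ω (d n))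
  measurable : ∀ n, Measurable (Function.uncurry (X n))
  update_left : ∀ n ω u, W n (Function.update ω (d n) u) = W n ω
  update_right : ∀ n ω u, X n (Function.update ω (d n) u) = X n ω
  subgaussian : ∀ n ω, HasSubgaussianMGF (X n ω) c (μ (d n))

namespace IsSubgaussianWalk

variable {μ} {d : ℕ → ι} {c : ℝ≥0} {W : ℕ → (∀ i, Ω i) → ℝ} {X : ∀ n, (∀ i, Ω i) → Ω (d n) → ℝ}

theorem measurable_left (H : IsSubgaussianWalk μ d c W X) (n : ℕ) : Measurable (W n) := by
  induction n with
  | zero => simpa only [funext H.zero] using measurable_const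
  | succ n ih =>
    rw [funext (H.succ n)]
    exact ih.add ((H.measurable n).comp (measurable_id.prodMk (measurable_pi_apply (d n))))

end IsSubgaussianWalk

variable [∀ i, IsProbabilityMeasure (μ i)]

theorem map_update_infinitePi (t : ι) :
    ((Measure.infinitePi μ).prod (μ t)).map (fun p => Function.update p.1 t p.2) =
      Measure.infinitePi μ := by
  refine Measure.eq_infinitePi _ fun s A hA => ?_
  have hpre : (fun p : (∀ i, Ω i) × Ω t => Function.update p.1 t p.2) ⁻¹' Set.pi s A =
      Set.pi (s.erase t : Finset ι) A ×ˢ (if t ∈ s then A t else Set.univ) := by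
    ext ⟨ω, u⟩
    simp only [Set.mem_preimage, Set.mem_pi, Finset.mem_coe, Set.mem_prod, Finset.mem_erase]
    refine ⟨fun H => ⟨fun i hi => by simpa [hi.1] using H i hi.2, ?_⟩, fun ⟨H, Ht⟩ i hi => ?_⟩
    · split_ifs with ht
      · simpa using H t ht
      · trivial
    · by_cases hit : i = t
      · subst hit; simpa [hi] using Ht
      · simpa [hit] using H i ⟨hit, hi⟩
  rw [Measure.map_apply (by fun_prop) (.pi s.countable_toSet fun i _ => hA i), hpre,
    Measure.prod_prod, Measure.infinitePi_pi _ fun i _ => hA i]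
  split_ifs with ht
  · exact Finset.prod_erase_mul s _ ht
  · rw [Finset.erase_eq_of_notMem ht, measure_univ, mul_one]

variable {μ} {d : ℕ → ι} {c : ℝ≥0} {W : ℕ → (∀ i, Ω i) → ℝ} {X : ∀ n, (∀ i, Ω i) → Ω (d n) → ℝ}

theorem IsSubgaussianWalk.hasSubgaussianMGF (H : IsSubgaussianWalk μ d c W X) (n : ℕ) :
    HasSubgaussianMGF (W n) (n * c) (Measure.infinitePi μ) := by
  induction n with
  | zero => simp [funext H.zero]
  | succ n ih =>
    have hupd : Measurable fun p : (∀ i, Ω i) × Ω (d n) => Function.update p.1 (d n) p.2 := by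
      fun_prop
    have hW : (fun p : (∀ i, Ω i) × Ω (d n) => W (n + 1) (Function.update p.1 (d n) p.2)) =
        fun p => W n p.1 + X n p.1 p.2 := funext fun p => by
      rw [H.succ, H.update_left, H.update_right, Function.update_self]
    have hadd := hasSubgaussianMGF_prod_add (H.measurable_left n) (H.measurable n) ih
      (H.subgaussian n)
    rw [← hW] at hadd
    rw [Nat.cast_succ, add_one_mul]
    refine hadd.congr_identDistrib
      ⟨((H.measurable_left _).comp hupd).aemeasurable, (H.measurable_left _).aemeasurable, ?_⟩
    rw [← Function.comp_def (W (n + 1)), ← Measure.map_map (H.measurable_left _) hupd,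
      map_update_infinitePi]

end Resampling

end Subgaussian

/-! ### Processes in numbered form -/

/-- A discounted Markov decision process as the machine sees it: states, state-action pairs and
transitions are numbered from `0`; the pair `j` belongs to the state `st j`, and the transition `e`
leads from the pair `row e` to the state `col e` with probability `P e`. Values outside the stated
ranges are irrelevant. -/
structure TabularMDP where
  numStates : ℕ
  numPairs : ℕ
  numEntries : ℕ
  st : ℕ → ℕ
  row : ℕ → ℕ
  col : ℕ → ℕ
  r : ℕ → ℝ
  P : ℕ → ℝ
  γ : ℝ
  row_lt : ∀ e < numEntries, row e < numPairs
  col_lt : ∀ e < numEntries, col e < numStates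
  row_mono : ∀ e e', e ≤ e' → e' < numEntries → row e ≤ row e'
  P_nonneg : ∀ e < numEntries, 0 ≤ P e
  row_sum : ∀ j < numPairs, ∑ e ∈ Finset.range numEntries with row e = j, P e = 1
  γ_nonneg : 0 ≤ γ
  γ_lt_one : γ < 1

namespace TabularMDP

variable (D : TabularMDP)

/-- The expectation of `v` at the next state after the pair `j`. -/
noncomputable def next (v : ℕ → ℝ) (j : ℕ) : ℝ :=
  ∑ e ∈ Finset.range D.numEntries with D.row e = j, D.P e * v (D.col e)

/-- The Bellman optimality equation: `u s` is the largest one-step value of a pair of `s`. -/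
def SolvesBellman (u : ℕ → ℝ) : Prop :=
  ∀ s < D.numStates, (∀ j < D.numPairs, D.st j = s → D.r j + D.γ * D.next u j ≤ u s) ∧
    ∃ j < D.numPairs, D.st j = s ∧ u s = D.r j + D.γ * D.next u j

end TabularMDP

namespace DMDP

variable {S : Type} [Fintype S] {A : S → Type} [∀ s, Fintype (A s)] (M : DMDP S A)

theorem numStates_le_numPairs [∀ s, Nonempty (A s)] : M.numStates ≤ M.numPairs :=
  Fintype.card_le_of_surjective (Sigma.fst : (Σ s, A s) → S) fun s =>
    ⟨⟨s, Classical.arbitrary _⟩, rfl⟩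

theorem nnz_le_numPairs_mul_numStates : M.nnz ≤ M.numPairs * M.numStates := by
  rw [DMDP.nnz, DMDP.numPairs, DMDP.numStates, ← Fintype.card_prod, ← Nat.card_eq_fintype_card]
  exact Nat.card_le_card_of_injective _ Subtype.val_injective

namespace Numbering

variable {M} (I : M.Numbering)

/-- The number of the state of the pair number `j`. -/
noncomputable def st (j : ℕ) : ℕ :=
  if h : j < M.numPairs then I.state.symm (I.pair ⟨j, h⟩).1 else 0

/-- The number of the pair from which the entry number `e` leads. -/
noncomputable def row (e : ℕ) : ℕ :=
  if h : e < M.nnz then I.pair.symm (I.entry ⟨e, h⟩).1.1 else 0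

/-- The number of the state to which the entry number `e` leads. -/
noncomputable def col (e : ℕ) : ℕ :=
  if h : e < M.nnz then I.state.symm (I.entry ⟨e, h⟩).1.2 else 0

/-- The reward of the pair number `j`. -/
noncomputable def reward (j : ℕ) : ℝ :=
  if h : j < M.numPairs then M.r (I.pair ⟨j, h⟩) else 0

/-- The value of the entry number `e`. -/
noncomputable def prob (e : ℕ) : ℝ :=
  if h : e < M.nnz then M.P (I.entry ⟨e, h⟩).1.1 (I.entry ⟨e, h⟩).1.2 else 0

theorem sum_entry (F : (Σ s, A s) × S → ℝ) (hF : ∀ x, M.P x.1 x.2 = 0 → F x = 0) :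
    ∑ e, F (I.entry e).1 = ∑ x, F x := by
  classical
  have : Fintype M.Nonzeros := Fintype.ofEquiv _ I.entry
  rw [Equiv.sum_comp I.entry fun z : M.Nonzeros => F z.1, ← Finset.sum_filter_of_ne
    (p := fun x : (Σ s, A s) × S => M.P x.1 x.2 ≠ 0) fun x _ hx => mt (hF x) hx]
  exact (Finset.sum_subtype _ (by simp) F).symm

theorem sum_row (w : S → ℝ) {f : ℕ → ℝ} (hf : ∀ e : Fin M.nnz, f e = w (I.entry e).1.2)
    (j : Fin M.numPairs) :
    ∑ e ∈ Finset.range M.nnz with I.row e = j, I.prob e * f e =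
      ∑ s', M.P (I.pair j) s' * w s' := by
  classical
  have hrow : ∀ e : Fin M.nnz, I.row e = j ↔ (I.entry e).1.1 = I.pair j := fun e => by
    rw [← Equiv.symm_apply_eq, Fin.ext_iff]
    simp [row]
  let F (x : (Σ s, A s) × S) : ℝ := if x.1 = I.pair j then M.P x.1 x.2 * w x.2 else 0
  calc _ = ∑ e, F (I.entry e).1 := by
        rw [Finset.sum_filter, Finset.sum_range]
        exact Finset.sum_congr rfl fun e _ => by simp [F, hrow, prob, hf]
    _ = ∑ x, F x := I.sum_entry F fun x hx => by simp [F, hx]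
    _ = _ := by
        rw [Fintype.sum_prod_type]
        simp [F, Finset.sum_ite_irrel]

/-- The process in terms of the numbers of its states, pairs and nonzero entries. -/
noncomputable def toTabular : TabularMDP where
  numStates := M.numStates
  numPairs := M.numPairs
  numEntries := M.nnz
  st := I.st
  row := I.row
  col := I.col
  r := I.reward
  P := I.prob
  γ := M.γ
  row_lt e he := by simp [row, he]
  col_lt e he := by simp [col, he]
  row_mono e e' hee he' := by
    have he := hee.trans_lt he'
    simp only [row, he, he', dite_true]
    exact I.entry_sorted (a := ⟨e, he⟩) (b := ⟨e', he'⟩) hee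
  P_nonneg e he := by simp only [prob, he, dite_true]; exact M.P_nonneg _ _
  row_sum j hj := by
    simpa [M.P_sum] using I.sum_row (fun _ => 1) (f := fun _ => 1) (fun _ => rfl) ⟨j, hj⟩
  γ_nonneg := M.γ_nonneg
  γ_lt_one := M.γ_lt_one

theorem next_toTabular (v : ℕ → ℝ) (j : Fin M.numPairs) :
    I.toTabular.next v j = ∑ s', M.P (I.pair j) s' * v (I.state.symm s') :=
  I.sum_row (fun s => v (I.state.symm s)) (fun e => by simp [toTabular, col]) j

theorem toTabular_backup (v : ℕ → ℝ) (j : Fin M.numPairs) :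
    I.toTabular.r j + I.toTabular.γ * I.toTabular.next v j =
      M.qValue (fun s => v (I.state.symm s)) (I.pair j) := by
  rw [next_toTabular]
  simp [toTabular, reward, qValue]

/-- A function of the states as a function of their numbers. -/
noncomputable def tabulate (w : S → ℝ) (i : ℕ) : ℝ :=
  if h : i < M.numStates then w (I.state ⟨i, h⟩) else 0

theorem tabulate_symm (w : S → ℝ) (s : S) : I.tabulate w (I.state.symm s) = w s := by
  simp [tabulate]

theorem abs_tabulate_optValue_le [∀ s, Nonempty (A s)] (i : ℕ) :
    |I.tabulate M.optValue i| ≤ 1 / (1 - M.γ) := by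
  unfold tabulate
  split_ifs with hi
  · rw [abs_of_nonneg (M.optValue_nonneg _)]
    exact M.optValue_le _
  · simpa using M.one_sub_γ_pos.le

theorem solvesBellman_tabulate_optValue [∀ s, Nonempty (A s)] :
    I.toTabular.SolvesBellman (I.tabulate M.optValue) := by
  intro s hs
  obtain ⟨s, rfl⟩ : ∃ s', s = I.state.symm s' := ⟨I.state ⟨s, hs⟩, by simp⟩
  simp only [tabulate_symm]
  refine ⟨fun j hj hjs => ?_, ?_⟩
  · have hst : (I.pair ⟨j, hj⟩).1 = s := by
      simpa [toTabular, st, show j < M.numPairs from hj, ← Fin.ext_iff] using hjs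
    rw [I.toTabular_backup _ ⟨j, hj⟩, ← hst]
    simp only [tabulate_symm]
    exact M.qValue_optValue_le _ _
  · obtain ⟨π, hπ⟩ := M.exists_policy_qValue_optValue_eq
    refine ⟨I.pair.symm ⟨s, π s⟩, Fin.is_lt _, by simp [toTabular, st], ?_⟩
    rw [toTabular_backup]
    simp only [tabulate_symm, Equiv.apply_symm_apply, hπ]

end Numbering

end DMDP

/-! ### Sampling a transition by inversion of the cumulative sums -/

namespace TabularMDP

open Finset

variable (D : TabularMDP)

/-- The sum of the probabilities of the transitions before the transition `e`. -/
noncomputable def cum (e : ℕ) : ℝ := ∑ e' ∈ range e, D.P e'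

/-- The transition of the pair `j` that the random number `u` selects. As every row sums to `1`,
the transitions of row `j` account for the range `[j, j + 1]` of `cum`. -/
noncomputable def sample (j : ℕ) (u : ℝ) : ℕ :=
  open Classical in #{e ∈ range D.numEntries | D.cum (e + 1) < j + u}

/-- The transition of the pair `j` that `u` selects lies between `lo` and `hi`, both included. -/
structure IsBracket (j : ℕ) (u : ℝ) (lo hi : ℕ) : Prop where
  le : lo ≤ hi
  lt : hi < D.numEntries
  below : ∀ e < lo, D.cum (e + 1) < j + u
  above : j + u ≤ D.cum (hi + 1)

/-- The random numbers that select the transition `e` of the pair `j`. -/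
def cell (j e : ℕ) : Set unitInterval := {u | D.cum e < j + (u : ℝ) ∧ j + (u : ℝ) ≤ D.cum (e + 1)}

variable {D}

theorem cum_mono {e e' : ℕ} (h : e ≤ e') (he' : e' ≤ D.numEntries) : D.cum e ≤ D.cum e' :=
  sum_le_sum_of_subset_of_nonneg (range_mono h) fun i hi _ =>
    D.P_nonneg i ((mem_range.1 hi).trans_le he')

theorem sum_row_lt {j : ℕ} (hj : j ≤ D.numPairs) :
    ∑ e ∈ range D.numEntries with D.row e < j, D.P e = j := by
  induction j with
  | zero => simp
  | succ j ih =>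
    have hsplit : {e ∈ range D.numEntries | D.row e < j + 1} =
        {e ∈ range D.numEntries | D.row e < j} ∪ {e ∈ range D.numEntries | D.row e = j} := by
      ext e
      simp only [mem_filter, mem_union, mem_range]
      omega
    rw [hsplit, sum_union (disjoint_filter.2 fun _ _ => ne_of_lt), ih (by omega), D.row_sum j hj]
    push_cast
    rfl

theorem row_le_cum {e : ℕ} (he : e < D.numEntries) : D.row e ≤ D.cum e := by
  rw [← sum_row_lt (D.row_lt e he).le]
  refine sum_le_sum_of_subset_of_nonneg (fun i hi => ?_) fun i hi _ =>
    D.P_nonneg i ((mem_range.1 hi).trans he)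
  simp only [mem_filter, mem_range] at hi ⊢
  by_contra h
  have := D.row_mono e i (by omega) hi.1
  omega

theorem cum_succ_le {e : ℕ} (he : e < D.numEntries) : D.cum (e + 1) ≤ D.row e + 1 := by
  rw [← Nat.cast_succ, ← sum_row_lt (D.row_lt e he)]
  refine sum_le_sum_of_subset_of_nonneg (fun i hi => ?_) fun i hi _ =>
    D.P_nonneg i (mem_range.1 (mem_filter.1 hi).1)
  simp only [mem_filter, mem_range] at hi ⊢
  exact ⟨by omega, Nat.lt_succ_of_le (D.row_mono i e (by omega) he)⟩

theorem cum_numEntries : D.cum D.numEntries = D.numPairs := by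
  rw [← sum_row_lt le_rfl, cum, filter_true_of_mem]
  exact fun e he => D.row_lt e (mem_range.1 he)

theorem sample_eq {j e : ℕ} {u : ℝ} (he : e < D.numEntries)
    (hlt : ∀ e' < e, D.cum (e' + 1) < j + u) (hle : j + u ≤ D.cum (e + 1)) :
    D.sample j u = e := by
  classical
  have hset : {e ∈ range D.numEntries | D.cum (e + 1) < j + u} = range e := by
    ext i
    simp only [mem_filter, mem_range]
    refine ⟨fun hi => ?_, fun hi => ⟨hi.trans he, hlt i hi⟩⟩
    by_contra hei
    exact hi.2.not_ge (hle.trans (cum_mono (by omega) hi.1))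
  rw [sample]
  convert card_range e

namespace IsBracket

variable {j lo hi mid : ℕ} {u : ℝ}

theorem sample_eq (h : D.IsBracket j u lo lo) : D.sample j u = lo :=
  TabularMDP.sample_eq h.lt h.below h.above

theorem zero_pred (hj : j < D.numPairs) (hu : u ≤ 1) :
    D.IsBracket j u 0 (D.numEntries - 1) := by
  have hne : 0 < D.numEntries := Nat.pos_of_ne_zero fun h => by
    simpa [h] using D.row_sum j hj
  refine ⟨Nat.zero_le _, Nat.sub_one_lt_of_lt hne, fun e he => absurd he (Nat.not_lt_zero e), ?_⟩
  rw [Nat.sub_add_cancel hne, cum_numEntries]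
  have : (j : ℝ) + 1 ≤ D.numPairs := by exact_mod_cast hj
  linarith

theorem lower_half (h : D.IsBracket j u lo hi) (hlo : lo ≤ mid) (hhi : mid < hi)
    (hmid : j + u ≤ D.cum (mid + 1)) : D.IsBracket j u lo mid :=
  ⟨hlo, hhi.trans h.lt, h.below, hmid⟩

theorem upper_half (h : D.IsBracket j u lo hi) (hhi : mid < hi)
    (hmid : D.cum (mid + 1) < j + u) : D.IsBracket j u (mid + 1) hi :=
  ⟨hhi, h.lt, fun _ he => (cum_mono he (hhi.trans h.lt)).trans_lt hmid, h.above⟩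

end IsBracket

theorem sample_lt {j : ℕ} (hj : j < D.numPairs) {u : ℝ} (hu : u ≤ 1) :
    D.sample j u < D.numEntries := by
  classical
  have hbr := IsBracket.zero_pred hj hu
  calc D.sample j u < #(range D.numEntries) := by
        rw [sample]
        convert card_lt_card (filter_ssubset (p := fun e => D.cum (e + 1) < j + u).2
          ⟨D.numEntries - 1, mem_range.2 hbr.lt, hbr.above.not_gt⟩)
    _ = D.numEntries := card_range _

theorem measurable_sample (j : ℕ) : Measurable fun u : unitInterval => D.sample j u := by
  classical
  simp only [sample, card_filter]
  exact Finset.measurable_sum _ fun e _ => Measurable.ite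
    (measurableSet_lt measurable_const (measurable_subtype_coe.const_add _)) measurable_const
    measurable_const

theorem measurableSet_cell (j e : ℕ) : MeasurableSet (D.cell j e) :=
  (measurableSet_lt measurable_const (measurable_subtype_coe.const_add _)).inter
    (measurableSet_le (measurable_subtype_coe.const_add _) measurable_const)

theorem sample_eq_of_mem_cell {j e : ℕ} (he : e < D.numEntries) {u : unitInterval}
    (hu : u ∈ D.cell j e) : D.sample j u = e :=
  sample_eq he (fun _ h => (cum_mono h he.le).trans_lt hu.1) hu.2

theorem volume_cell {e : ℕ} (he : e < D.numEntries) :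
    volume (D.cell (D.row e) e) = ENNReal.ofReal (D.P e) := by
  have hlow := row_le_cum he
  have hhigh := cum_succ_le he
  have hmono := cum_mono (D := D) e.le_succ he
  have hIoc : D.cell (D.row e) e =
      Set.Ioc (⟨D.cum e - D.row e, by constructor <;> linarith⟩ : unitInterval)
        ⟨D.cum (e + 1) - D.row e, by constructor <;> linarith⟩ := by
    ext u
    simp only [cell, Set.mem_ofPred_eq, Set.mem_Ioc, ← Subtype.coe_lt_coe, ← Subtype.coe_le_coe,
      sub_lt_iff_lt_add', le_sub_iff_add_le']
  rw [hIoc, unitInterval.volume_Ioc]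
  simp [cum, sum_range_succ]

theorem pairwiseDisjoint_cell (j : ℕ) :
    (range D.numEntries : Set ℕ).PairwiseDisjoint (D.cell j) := fun _ he _ he' hne =>
  Set.disjoint_left.2 fun _ hu hu' => hne <|
    (sample_eq_of_mem_cell (mem_range.1 he) hu).symm.trans
      (sample_eq_of_mem_cell (mem_range.1 he') hu')

theorem ae_mem_cell {j : ℕ} (hj : j < D.numPairs) :
    ∀ᵐ u, u ∈ ⋃ e ∈ {e ∈ range D.numEntries | D.row e = j}, D.cell j e := by
  refine (mem_ae_iff_prob_eq_one <|
    Finset.measurableSet_biUnion _ fun e _ => measurableSet_cell j e).2 ?_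
  rw [measure_biUnion_finset ((pairwiseDisjoint_cell j).subset (coe_subset.2 (filter_subset _ _)))
    fun e _ => measurableSet_cell j e]
  calc _ = ∑ e ∈ range D.numEntries with D.row e = j, ENNReal.ofReal (D.P e) :=
        sum_congr rfl fun e he => by
          obtain ⟨he', rfl⟩ := mem_filter.1 he
          exact volume_cell (mem_range.1 he')
    _ = 1 := by
        rw [← ENNReal.ofReal_sum_of_nonneg fun e he =>
          D.P_nonneg e (mem_range.1 (mem_filter.1 he).1), D.row_sum j hj, ENNReal.ofReal_one]

theorem integral_sample {j : ℕ} (hj : j < D.numPairs) (f : ℕ → ℝ) :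
    ∫ u : unitInterval, f (D.col (D.sample j u)) = D.next f j := by
  have hcell : ∀ e ∈ ({e ∈ range D.numEntries | D.row e = j} : Finset ℕ),
      Set.EqOn (fun u : unitInterval => f (D.col (D.sample j u))) (fun _ => f (D.col e))
        (D.cell j e) := fun e he u hu => by
    simp only [sample_eq_of_mem_cell (mem_range.1 (mem_filter.1 he).1) hu]
  have hcover : (⋃ e ∈ {e ∈ range D.numEntries | D.row e = j}, D.cell j e) =ᵐ[volume] Set.univ :=
    Filter.eventuallyEq_univ.2 (ae_mem_cell hj)
  rw [← setIntegral_univ, ← setIntegral_congr_set hcover,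
    integral_biUnion_finset _ (fun e _ => measurableSet_cell j e)
      ((pairwiseDisjoint_cell j).subset (coe_subset.2 (filter_subset _ _)))
      fun e he => (integrableOn_const (by finiteness)).congr_fun (hcell e he).symm
        (measurableSet_cell j e)]
  refine sum_congr rfl fun e he => ?_
  rw [setIntegral_congr_fun (measurableSet_cell j e) (hcell e he), setIntegral_const]
  obtain ⟨he', rfl⟩ := mem_filter.1 he
  rw [mem_range] at he'
  rw [measureReal_def, volume_cell he', ENNReal.toReal_ofReal (D.P_nonneg e he'), smul_eq_mul]

end TabularMDP

/-! ### Truncated variance-reduced value iteration -/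

namespace TabularMDP

open Finset

variable (D : TabularMDP)

/-- The change of the value of the state `s` in a round of value iteration, truncated to `[-h, h]`;
`z` consists of the values and of an estimate of their expectation at the next state. -/
noncomputable def change (h : ℝ) (z : (ℕ → ℝ) × (ℕ → ℝ)) (s : ℕ) : ℝ :=
  {j ∈ range D.numPairs | D.st j = s}.fold max (-h) fun j =>
    min h (D.r j + D.γ * z.2 j - z.1 s)

/-- A round of value iteration. The estimate for the pair `j` is updated with the change of the
value of a single state, which is sampled from the transitions of `j`. -/
noncomputable def round (h : ℝ) (u : unitInterval) (z : (ℕ → ℝ) × (ℕ → ℝ)) :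
    (ℕ → ℝ) × (ℕ → ℝ) :=
  (fun s => z.1 s + D.change h z s, fun j => z.2 j + D.change h z (D.col (D.sample j u)))

/-- The values and the estimates after `i` rounds that start from the values `v` with exact
estimates and use the random numbers from number `t` on. -/
noncomputable def rounds (h : ℝ) (ω : RealRAM.Tape) (t : ℕ) (v : ℕ → ℝ) :
    ℕ → (ℕ → ℝ) × (ℕ → ℝ)
  | 0 => (v, D.next v)
  | i + 1 => D.round h (ω (t + i)) (rounds h ω t v i)

/-- The values after `k` epochs of `L` rounds each; the truncation width is `h` in the first epoch
and is halved from each epoch to the next. -/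
noncomputable def epochs (h : ℝ) (L : ℕ) (ω : RealRAM.Tape) : ℕ → ℕ → ℝ
  | 0 => 0
  | k + 1 => (D.rounds (h / 2 ^ k) ω (k * L) (epochs h L ω k) L).1

/-- The error of an estimate after `i` rounds. -/
noncomputable def error (h : ℝ) (ω : RealRAM.Tape) (t : ℕ) (v : ℕ → ℝ) (i j : ℕ) : ℝ :=
  (D.rounds h ω t v i).2 j - D.next (D.rounds h ω t v i).1 j

/-- In all rounds of the first `K` epochs, the errors of the estimates are at most `m` times the
truncation width. -/
def EstimatesAccurate (h m : ℝ) (L K : ℕ) (ω : RealRAM.Tape) : Prop :=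
  ∀ k < K, ∀ i < L, ∀ j < D.numPairs,
    |D.error (h / 2 ^ k) ω (k * L) (D.epochs h L ω k) i j| ≤ m * (h / 2 ^ k)

variable {D}

theorem change_le {h b : ℝ} {z : (ℕ → ℝ) × (ℕ → ℝ)} {s : ℕ} (hb : -h ≤ b)
    (H : ∀ j < D.numPairs, D.st j = s → min h (D.r j + D.γ * z.2 j - z.1 s) ≤ b) :
    D.change h z s ≤ b :=
  (fold_max_le _).2 ⟨hb, fun j hj => H j (mem_range.1 (mem_filter.1 hj).1) (mem_filter.1 hj).2⟩

theorem le_change {h : ℝ} {z : (ℕ → ℝ) × (ℕ → ℝ)} {s j : ℕ} (hj : j < D.numPairs)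
    (hs : D.st j = s) : min h (D.r j + D.γ * z.2 j - z.1 s) ≤ D.change h z s :=
  (le_fold_max _).2 (.inr ⟨j, mem_filter.2 ⟨mem_range.2 hj, hs⟩, le_rfl⟩)

theorem change_congr {h : ℝ} {z z' : (ℕ → ℝ) × (ℕ → ℝ)} {s : ℕ} (hv : z.1 s = z'.1 s)
    (hx : ∀ j < D.numPairs, z.2 j = z'.2 j) : D.change h z s = D.change h z' s :=
  fold_congr fun j hj => by rw [hv, hx j (mem_range.1 (mem_filter.1 hj).1)]

theorem abs_change_le {h : ℝ} (hh : 0 ≤ h) (z : (ℕ → ℝ) × (ℕ → ℝ)) (s : ℕ) :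
    |D.change h z s| ≤ h :=
  abs_le.2 ⟨(le_fold_max _).2 (.inl le_rfl), change_le (by linarith) fun _ _ _ => min_le_left _ _⟩

theorem next_congr {v w : ℕ → ℝ} (hv : ∀ s < D.numStates, v s = w s) (j : ℕ) :
    D.next v j = D.next w j :=
  sum_congr rfl fun e he => by rw [hv _ (D.col_lt e (mem_range.1 (mem_filter.1 he).1))]

theorem next_add (v w : ℕ → ℝ) (j : ℕ) :
    D.next (fun s => v s + w s) j = D.next v j + D.next w j := by
  simp [next, mul_add, sum_add_distrib]

theorem abs_next_sub_le {v w : ℕ → ℝ} {a : ℝ} (h : ∀ s < D.numStates, |v s - w s| ≤ a) {j : ℕ}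
    (hj : j < D.numPairs) : |D.next v j - D.next w j| ≤ a := by
  rw [next, next, ← sum_sub_distrib]
  calc _ ≤ ∑ e ∈ range D.numEntries with D.row e = j, D.P e * a := by
        refine (abs_sum_le_sum_abs _ _).trans (sum_le_sum fun e he => ?_)
        have he' := mem_range.1 (mem_filter.1 he).1
        rw [← mul_sub, abs_mul, abs_of_nonneg (D.P_nonneg e he')]
        exact mul_le_mul_of_nonneg_left (h _ (D.col_lt e he')) (D.P_nonneg e he')
    _ = a := by rw [← sum_mul, D.row_sum j hj, one_mul]

theorem abs_γ_mul_sub_next_le {u : ℕ → ℝ} {z : (ℕ → ℝ) × (ℕ → ℝ)} {a b : ℝ}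
    (hv : ∀ s < D.numStates, |z.1 s - u s| ≤ a)
    (hx : ∀ j < D.numPairs, |z.2 j - D.next z.1 j| ≤ b) {j : ℕ} (hj : j < D.numPairs) :
    |D.γ * z.2 j - D.γ * D.next u j| ≤ D.γ * (a + b) := by
  rw [← mul_sub, abs_mul, abs_of_nonneg D.γ_nonneg]
  refine mul_le_mul_of_nonneg_left ?_ D.γ_nonneg
  linarith [hx j hj, abs_next_sub_le hv hj, abs_sub_le (z.2 j) (D.next z.1 j) (D.next u j)]

theorem abs_add_change_sub_le {u : ℕ → ℝ} (hu : D.SolvesBellman u) {z : (ℕ → ℝ) × (ℕ → ℝ)}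
    {h a b : ℝ} (hv : ∀ s < D.numStates, |z.1 s - u s| ≤ a)
    (hx : ∀ j < D.numPairs, |z.2 j - D.next z.1 j| ≤ b) {s : ℕ} (hs : s < D.numStates) :
    |z.1 s + D.change h z s - u s| ≤ max (D.γ * (a + b)) (a - h) := by
  have hq := fun j hj => abs_le.1 (abs_γ_mul_sub_next_le hv hx (j := j) hj)
  have hvs := abs_le.1 (hv s hs)
  have hmax := le_max_left (D.γ * (a + b)) (a - h)
  have hmax' := le_max_right (D.γ * (a + b)) (a - h)
  obtain ⟨hle, j, hj, hjs, hju⟩ := hu s hs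
  rw [abs_le]
  constructor
  · have hlow := le_change (h := h) (z := z) hj hjs
    rcases min_le_iff.1 hlow with hlow | hlow <;> linarith [hq j hj]
  · have hhigh : D.change h z s ≤ u s - z.1 s + max (D.γ * (a + b)) (a - h) :=
      change_le (by linarith) fun i hi his =>
        (min_le_right _ _).trans (by linarith [hle i hi his, hq i hi])
    linarith

theorem abs_rounds_sub_le {u v : ℕ → ℝ} (hu : D.SolvesBellman u) {N h b : ℝ} {L : ℕ}
    (hγ : 1 ≤ N * (1 - D.γ)) (hh : 0 ≤ h) (hhb : h ≤ b) (hL : L * h ≤ 2 * N * b)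
    {ω : RealRAM.Tape} {t : ℕ} (hv : ∀ s < D.numStates, |v s - u s| ≤ 4 * N * b)
    (herr : ∀ i < L, ∀ j < D.numPairs, |D.error h ω t v i j| ≤ b)
    {i : ℕ} (hi : i ≤ L) {s : ℕ} (hs : s < D.numStates) :
    |(D.rounds h ω t v i).1 s - u s| ≤ 4 * N * b - i * h := by
  induction i generalizing s with
  | zero => simpa [rounds] using hv s hs
  | succ i ih =>
    refine (abs_add_change_sub_le hu (fun s => ih (by omega)) (herr i (by omega)) hs).trans
      (max_le ?_ (by push_cast; linarith))
    have hiL : (i : ℝ) * h ≤ L * h := by gcongr; omega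
    have hfar : 2 * b ≤ (1 - D.γ) * (4 * N * b - i * h + b) := calc
      2 * b ≤ 2 * b * (N * (1 - D.γ)) := le_mul_of_one_le_right (by linarith) hγ
      _ = (1 - D.γ) * (2 * N * b) := by ring
      _ ≤ (1 - D.γ) * (4 * N * b - i * h + b) :=
        mul_le_mul_of_nonneg_left (by linarith) (sub_nonneg.2 D.γ_lt_one.le)
    push_cast
    linarith

theorem abs_epochs_sub_le {u : ℕ → ℝ} (hu : D.SolvesBellman u) {N h m : ℝ} {L : ℕ}
    (hγ : 1 ≤ N * (1 - D.γ)) (hh : 0 ≤ h) (hm : 1 ≤ m) (hL : L = 2 * N * m)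
    (hu₀ : ∀ s < D.numStates, |u s| ≤ 4 * N * (m * h)) {ω : RealRAM.Tape} {K : ℕ}
    (herr : D.EstimatesAccurate h m L K ω) {s : ℕ} (hs : s < D.numStates) :
    |D.epochs h L ω K s - u s| ≤ 4 * N * (m * h) / 2 ^ K := by
  induction K generalizing s with
  | zero => simpa [epochs] using hu₀ s hs
  | succ K ih =>
    have hstep := abs_rounds_sub_le hu (h := h / 2 ^ K) (b := m * (h / 2 ^ K)) hγ (by positivity)
      (le_mul_of_one_le_left (by positivity) hm) (by rw [hL, mul_assoc])
      (fun s hs => (ih (fun k hk => herr k (by omega)) hs).trans_eq (by ring))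
      (herr K (by omega)) le_rfl hs
    refine hstep.trans_eq ?_
    rw [hL, pow_succ]
    field_simp
    ring

end TabularMDP

/-! ### Concentration of the estimates -/

namespace TabularMDP

open Finset ProbabilityTheory RealRAM
open scoped NNReal

variable {D : TabularMDP}

instance : IsProbabilityMeasure tapeMeasure := by
  unfold tapeMeasure
  infer_instance

/-- The error that a round adds to the estimate for the pair `j`. -/
noncomputable def noise (D : TabularMDP) (h : ℝ) (j : ℕ) (z : (ℕ → ℝ) × (ℕ → ℝ))
    (u : unitInterval) : ℝ :=
  D.change h z (D.col (D.sample j u)) - D.next (D.change h z) j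

theorem measurable_change (h : ℝ) (s : ℕ) : Measurable fun z => D.change h z s := by
  unfold change
  induction {j ∈ range D.numPairs | D.st j = s} using Finset.induction_on with
  | empty => simp
  | insert a F ha ih =>
    simp only [fold_insert ha]
    fun_prop

theorem measurable_next (j : ℕ) : Measurable fun v => D.next v j := by
  unfold next
  fun_prop

theorem measurable_change_sample (h : ℝ) (j : ℕ) :
    Measurable fun p : ((ℕ → ℝ) × (ℕ → ℝ)) × unitInterval =>
      D.change h p.1 (D.col (D.sample j p.2)) :=
  (measurable_from_prod_countable_left (f := fun p : ((ℕ → ℝ) × (ℕ → ℝ)) × ℕ =>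
    D.change h p.1 (D.col p.2)) fun e => measurable_change h (D.col e)).comp
      (measurable_fst.prodMk ((measurable_sample j).comp measurable_snd))

theorem measurable_noise (h : ℝ) (j : ℕ) : Measurable (Function.uncurry (D.noise h j)) :=
  (measurable_change_sample h j).sub <| ((measurable_next j).comp
    (measurable_pi_lambda _ (measurable_change h))).comp measurable_fst

theorem measurable_round (h : ℝ) :
    Measurable fun p : ((ℕ → ℝ) × (ℕ → ℝ)) × unitInterval => D.round h p.2 p.1 := by
  have hchange := measurable_change (D := D) h
  have hsample := measurable_change_sample (D := D) h
  unfold round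
  fun_prop

theorem measurable_rounds (h : ℝ) (t : ℕ) {v : Tape → ℕ → ℝ} (hv : Measurable v) (i : ℕ) :
    Measurable fun ω => D.rounds h ω t (v ω) i := by
  induction i with
  | zero => exact hv.prodMk (measurable_pi_lambda _ fun j => (measurable_next j).comp hv)
  | succ i ih => exact (measurable_round h).comp (ih.prodMk (measurable_pi_apply (t + i)))

theorem measurable_epochs (h : ℝ) (L k : ℕ) : Measurable fun ω => D.epochs h L ω k := by
  induction k with
  | zero => exact measurable_const
  | succ k ih => exact measurable_fst.comp (measurable_rounds _ _ ih L)

theorem rounds_congr (h : ℝ) {ω ω' : Tape} {t i : ℕ} (v : ℕ → ℝ)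
    (H : ∀ l < t + i, ω l = ω' l) : D.rounds h ω t v i = D.rounds h ω' t v i := by
  induction i with
  | zero => rfl
  | succ i ih => rw [rounds, rounds, ih fun l hl => H l (by omega), H (t + i) (by omega)]

theorem epochs_congr (h : ℝ) {ω ω' : Tape} {L k : ℕ} (H : ∀ l < k * L, ω l = ω' l) :
    D.epochs h L ω k = D.epochs h L ω' k := by
  induction k with
  | zero => rfl
  | succ k ih =>
    rw [epochs, epochs, ih fun l hl => H l (hl.trans_le (Nat.mul_le_mul_right L k.le_succ)),
      rounds_congr _ _ fun l hl => H l (hl.trans_eq (k.succ_mul L).symm)]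

theorem hasSubgaussianMGF_noise (h : ℝ≥0) {j : ℕ} (hj : j < D.numPairs)
    (z : (ℕ → ℝ) × (ℕ → ℝ)) : HasSubgaussianMGF (D.noise h j z) (h ^ 2) volume := by
  have hmeas : Measurable fun u : unitInterval => D.change h z (D.col (D.sample j u)) :=
    (measurable_from_top (f := fun e => D.change h z (D.col e))).comp (measurable_sample j)
  have hbound := hasSubgaussianMGF_of_mem_Icc hmeas.aemeasurable (μ := volume)
    (.of_forall fun u => abs_le.1 (abs_change_le h.2 z _))
  convert hbound using 1
  · simp only [integral_sample hj (D.change h z)]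
    rfl
  · ext
    simp [← two_mul]

theorem isSubgaussianWalk_error (h : ℝ≥0) (t : ℕ) {v : Tape → ℕ → ℝ}
    (hv : Measurable v) (hv' : ∀ ω ω' : Tape, (∀ l < t, ω l = ω' l) → v ω = v ω') {j : ℕ}
    (hj : j < D.numPairs) :
    IsSubgaussianWalk (fun _ : ℕ => (volume : Measure unitInterval)) (fun i => t + i)
      (h ^ 2) (fun i ω => D.error h ω t (v ω) i j)
      fun i ω => D.noise h j (D.rounds h ω t (v ω) i) := by
  have hupd : ∀ i (ω : Tape) u,
      D.rounds h (Function.update ω (t + i) u) t (v (Function.update ω (t + i) u)) i =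
        D.rounds h ω t (v ω) i := fun i ω u => by
    have H : ∀ l < t + i, Function.update ω (t + i) u l = ω l := fun l hl =>
      Function.update_of_ne hl.ne _ _
    rw [rounds_congr (h : ℝ) _ H, hv' _ ω fun l hl => H l (by omega)]
  refine ⟨fun ω => by simp [error, rounds], fun i ω => ?_, fun i => ?_, fun i ω u => ?_,
    fun i ω u => ?_, fun i ω => hasSubgaussianMGF_noise h hj _⟩
  · simp only [error, rounds, round, noise, next_add]
    ring
  · have hpair : Measurable fun p : Tape × unitInterval => (D.rounds h p.1 t (v p.1) i, p.2) :=
      ((measurable_rounds (h : ℝ) t hv i).comp measurable_fst).prodMk measurable_snd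
    have hcomp := (measurable_noise (D := D) (h : ℝ) j).comp hpair
    exact hcomp
  · simp only [error, hupd]
  · simp only [hupd]

theorem measure_le_abs_error_le {h m c : ℝ} (hh : 0 < h) (hm : 0 ≤ m) {L i : ℕ} (hi : i < L)
    (hc : 2 * c * L ≤ m ^ 2) (t : ℕ) {v : Tape → ℕ → ℝ} (hv : Measurable v)
    (hv' : ∀ ω ω' : Tape, (∀ l < t, ω l = ω' l) → v ω = v ω') {j : ℕ} (hj : j < D.numPairs) :
    tapeMeasure {ω | m * h ≤ |D.error h ω t (v ω) i j|} ≤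
      ENNReal.ofReal (2 * Real.exp (-c)) := by
  lift h to ℝ≥0 using hh.le
  have hsub : HasSubgaussianMGF (fun ω => D.error h ω t (v ω) i j) (L * h ^ 2) tapeMeasure :=
    hasSubgaussianMGF_mono ((isSubgaussianWalk_error h t hv hv' hj).hasSubgaussianMGF i)
      (by gcongr)
  refine (measure_le_abs_le_of_hasSubgaussianMGF hsub (by positivity)).trans
    (ENNReal.ofReal_le_ofReal ?_)
  have hL : (0 : ℝ) < L := by exact_mod_cast i.zero_le.trans_lt hi
  gcongr
  push_cast
  rw [neg_div, neg_le_neg_iff, le_div_iff₀ (by positivity)]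
  linarith [mul_le_mul_of_nonneg_right hc (sq_nonneg (h : ℝ))]

theorem measure_not_estimatesAccurate_le {h m c : ℝ} (hh : 0 < h) (hm : 0 ≤ m) {L : ℕ}
    (hc : 2 * c * L ≤ m ^ 2) (K : ℕ) :
    tapeMeasure {ω | ¬ D.EstimatesAccurate h m L K ω} ≤
      ENNReal.ofReal (K * L * D.numPairs * (2 * Real.exp (-c))) := by
  have hsub : {ω : Tape | ¬ D.EstimatesAccurate h m L K ω} ⊆
      ⋃ x ∈ range K ×ˢ range L ×ˢ range D.numPairs, {ω : Tape | m * (h / 2 ^ x.1) ≤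
        |D.error (h / 2 ^ x.1) ω (x.1 * L) (D.epochs h L ω x.1) x.2.1 x.2.2|} := fun ω hω => by
    simp only [EstimatesAccurate, Set.mem_ofPred_eq, not_forall, not_le] at hω
    obtain ⟨k, hk, i, hi, j, hj, hlt⟩ := hω
    simp only [Set.mem_iUnion, mem_product, mem_range]
    exact ⟨(k, i, j), ⟨hk, hi, hj⟩, hlt.le⟩
  calc _ ≤ _ := (measure_mono hsub).trans (measure_biUnion_finset_le _ _)
    _ ≤ #(range K ×ˢ range L ×ˢ range D.numPairs) • ENNReal.ofReal (2 * Real.exp (-c)) :=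
        sum_le_card_nsmul _ _ _ fun x hx => by
          simp only [mem_product, mem_range] at hx
          exact measure_le_abs_error_le (by positivity) hm hx.2.1 hc (x.1 * L)
            (measurable_epochs h L x.1) (fun ω ω' H => epochs_congr _ H) hx.2.2
    _ = ENNReal.ofReal (K * L * D.numPairs * (2 * Real.exp (-c))) := by
        rw [nsmul_eq_mul, ← ENNReal.ofReal_natCast, ← ENNReal.ofReal_mul (by positivity)]
        simp only [card_product, card_range, Nat.cast_mul, mul_assoc]

end TabularMDP

/-! ### The program

Besides the input and the output, the memory holds
* the loop counters, in the natural-number arrays `5`, `6` and `7`;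
* the bounds of a binary search, in the natural-number arrays `8` and `9`;
* the partial sums of the entries of the transition matrix, in the real array `4`;
* the estimated expected value of the next state for each pair, in the real array `5`;
* the change of the value of each state, in the real array `6`;
* the truncation width and the last random number, in the real arrays `7` and `8`;
* the horizon, the number of epochs, the logarithmic factor and the number of rounds of an epoch, in
  the real arrays `9`, `11`, `12` and `13`;
* temporary numbers, in the real arrays `10` and `14`. -/

namespace ValueIteration

open RealRAM

/-- The number in cell `0` of an array of reals. -/
@[simp] def scalar (a : ℕ) : RExp := .get a (.lit 0)

/-- The number `i` as a real. -/
@[simp] def const (i : ℕ) : RExp := .ofNat (.lit i)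

/-- The number of states (`i = 0`), of pairs (`i = 1`) or of transitions (`i = 2`). -/
@[simp] def size (i : ℕ) : RExp := .ofNat (.get 0 (.lit i))

/-- The innermost loop counter. -/
@[simp] def counter : NExp := .get 5 (.lit 0)

/-- The lower bound of the binary search. -/
@[simp] def lower : NExp := .get 8 (.lit 0)

/-- The upper bound of the binary search. -/
@[simp] def upper : NExp := .get 9 (.lit 0)

/-- The estimated total reward of a pair. -/
@[simp] def qExp (j : NExp) : RExp := .add (.get 1 j) (.mul (.get 0 (.lit 0)) (.get 5 j))

/-- Computes the least positive integer that is at least `(1 - γ)⁻¹`. -/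
def horizonProg : Prog :=
  .seq (.setReal 9 (.lit 0) (const 1))
    (.loop (.neg (.realLe (const 1) (.mul (scalar 9) (.sub (const 1) (scalar 0)))))
      (.setReal 9 (.lit 0) (.add (scalar 9) (const 1))))

/-- Computes the least `n` for which `2 ^ n` is at least the number in array `14`. -/
def logProg (a : ℕ) : Prog :=
  .seq (.seq (.setReal a (.lit 0) (const 0)) (.setReal 10 (.lit 0) (const 1)))
    (.loop (.neg (.realLe (scalar 14) (scalar 10)))
      (.seq (.setReal 10 (.lit 0) (.add (scalar 10) (scalar 10)))
        (.setReal a (.lit 0) (.add (scalar a) (const 1)))))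

/-- Computes the partial sums of the entries of the transition matrix. -/
def cumProg : Prog :=
  .seq (.setReal 10 (.lit 0) (const 0))
    (forLoop 5 (size 2)
      (.seq (.setReal 10 (.lit 0) (.add (scalar 10) (.get 2 counter)))
        (.setReal 4 counter (scalar 10))))

/-- Computes the expected value of the next state for each pair. -/
def nextProg : Prog :=
  .seq (forLoop 5 (size 1) (.setReal 5 counter (const 0)))
    (forLoop 5 (size 2) (.setReal 5 (.get 2 counter)
      (.add (.get 5 (.get 2 counter)) (.mul (.get 2 counter) (.get 3 (.get 3 counter))))))

/-- Computes the truncated change of the value of each state. -/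
def changeProg : Prog :=
  .seq (forLoop 5 (size 0) (.setReal 6 counter (.sub (const 0) (scalar 7))))
    (forLoop 5 (size 1)
      (.seq (.setReal 10 (.lit 0) (.sub (qExp counter) (.get 3 (.get 1 counter))))
        (.seq (.capReal 10 (.lit 0) (scalar 7)) (.raiseReal 6 (.get 1 counter) (scalar 10)))))

/-- Adds the changes to the values. -/
def addProg : Prog :=
  forLoop 5 (size 0) (.setReal 3 counter (.add (.get 3 counter) (.get 6 counter)))

/-- Finds the transition of the pair in `counter` that the last random number selects. -/
def bisectProg : Prog :=
  .loop (.neg (.natLe upper lower))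
    (.ite (.realLe (.add (.ofNat counter) (scalar 8)) (.get 4 (.half (.add lower upper))))
      (.setNat 9 (.lit 0) (.half (.add lower upper)))
      (.setNat 8 (.lit 0) (.add (.half (.add lower upper)) (.lit 1))))

/-- Updates the estimate of each pair with the change at a sampled next state. -/
def sampleProg : Prog :=
  forLoop 5 (size 1)
    (.seq (.seq (.setNat 8 (.lit 0) (.lit 0))
        (.setNat 9 (.lit 0) (.sub (.get 0 (.lit 2)) (.lit 1))))
      (.seq bisectProg
        (.setReal 5 counter (.add (.get 5 counter) (.get 6 (.get 3 lower))))))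

/-- A round of value iteration. -/
def roundProg : Prog :=
  .seq changeProg (.seq addProg (.seq (.draw 8 (.lit 0)) sampleProg))

/-- An epoch: exact estimates are followed by a number of rounds. -/
def epochProg : Prog :=
  .seq nextProg (.seq (forLoop 6 (scalar 13) roundProg)
    (.setReal 7 (.lit 0) (.div (scalar 7) (const 2))))

/-- Computes a greedy policy. -/
def greedyProg : Prog :=
  .seq nextProg
    (.seq (forLoop 5 (size 1) (.setNat 4 (.get 1 counter) counter))
      (forLoop 5 (size 1)
        (.ite (.realLe (qExp (.get 4 (.get 1 counter))) (qExp counter))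
          (.setNat 4 (.get 1 counter) counter) .skip)))

/-- Computes the parameters. -/
def paramProg : Prog :=
  .seq horizonProg
    (.seq (.setReal 14 (.lit 0)
        (.div (.mul (const 2) (.mul (scalar 9) (scalar 9))) (.get 0 (.lit 1))))
      (.seq (logProg 11)
        (.seq (.setReal 14 (.lit 0)
            (.div (.mul (.mul (const 32) (.add (scalar 11) (const 1)))
              (.mul (.mul (scalar 9) (scalar 9)) (size 1))) (.get 0 (.lit 2))))
          (.seq (logProg 12)
            (.seq (.setReal 13 (.lit 0)
                (.mul (const 16) (.mul (.mul (scalar 9) (scalar 9)) (scalar 12))))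
              (.setReal 7 (.lit 0)
                (.div (const 1) (.mul (const 32) (.mul (scalar 9) (scalar 12))))))))))

/-- Truncated variance-reduced value iteration. -/
def mainProg : Prog :=
  .seq paramProg (.seq cumProg (.seq (forLoop 7 (scalar 11) epochProg) greedyProg))

/-! ### Correctness and running time of the parts -/

attribute [local simp] NExp.eval RExp.eval Test.Holds Prog.wp

/-- The memory holds the process `D`. -/
structure Loaded (D : TabularMDP) (σ : State) : Prop where
  numStates : σ.nat 0 0 = D.numStates
  numPairs : σ.nat 0 1 = D.numPairs
  numEntries : σ.nat 0 2 = D.numEntries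
  st : σ.nat 1 = D.st
  row : σ.nat 2 = D.row
  col : σ.nat 3 = D.col
  γ : σ.real 0 0 = D.γ
  r : σ.real 1 = D.r
  P : σ.real 2 = D.P

variable {D : TabularMDP} {ω : Tape} {σ σ' : State}

theorem Loaded.frame {p : Prog} (h : Loaded D σ) (hF : Frame p σ σ')
    (hn : ∀ a < 4, p.writesNat a = false := by decide)
    (hr : ∀ a < 3, p.writesReal a = false := by decide) : Loaded D σ' := by
  have hnat : ∀ a < 4, σ'.nat a = σ.nat a := fun a ha => hF.nat a (hn a ha)
  have hreal : ∀ a < 3, σ'.real a = σ.real a := fun a ha => hF.real a (hr a ha)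
  obtain ⟨h1, h2, h3, h4, h5, h6, h7, h8, h9⟩ := h
  constructor <;> simp_all

theorem runs_horizonProg {N : ℕ}
    (hN : IsLeast {n : ℕ | 0 < n ∧ 1 ≤ n * (1 - σ.real 0 0)} N) :
    Runs ω horizonProg σ (4 + N * 20) fun σ' => σ'.real 9 0 = N := by
  obtain ⟨n, rfl⟩ := Nat.exists_eq_succ_of_ne_zero hN.1.1.ne'
  refine Runs.seq (R := fun σ' => σ'.real 9 0 = (0 + 1 : ℕ)) (Runs.of_wp (by simp))
    fun σ₁ hF₁ h₁ => Runs.loop (T := 7) (fun i σ' => σ'.real 9 0 = (i + 1 : ℕ)) n h₁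
      (fun i hi σ₂ hF₂ h₂ => ?_) (fun i _ σ₂ _ h₂ => Runs.of_wp (by simp [h₂])) (by decide)
  have hγ : σ₂.real 0 = σ.real 0 := by rw [hF₂.real 0 rfl, hF₁.real 0 rfl]
  rcases hi.lt_or_eq with hi | rfl
  · have : ¬ 1 ≤ ((i + 1 : ℕ) : ℝ) * (1 - σ.real 0 0) := fun h =>
      absurd (hN.2 ⟨i.succ_pos, h⟩) (by lia)
    simpa [h₂, hγ, hi] using this
  · simpa [h₂, hγ] using hN.1.2

theorem runs_logProg {a : ℕ} (ha : a ≠ 10) (ha' : a ≠ 14) {n : ℕ}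
    (hn : IsLeast {k : ℕ | σ.real 14 0 ≤ 2 ^ k} n) :
    Runs ω (logProg a) σ (8 + (n + 1) * 20) fun σ' => σ'.real a 0 = n := by
  refine (Runs.seq (R := fun σ' => σ'.real a 0 = (0 : ℕ) ∧ σ'.real 10 0 = 2 ^ 0)
    (Runs.of_wp (by simp [ha]) le_rfl) fun σ₁ hF₁ h₁ => Runs.loop
      (fun i σ' => σ'.real a 0 = i ∧ σ'.real 10 0 = 2 ^ i) n h₁ (fun i hi σ₂ hF₂ h₂ => ?_)
      (fun i _ σ₂ _ h₂ => Runs.of_wp ?_ le_rfl)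
      (by simp [Test.cost, Prog.cost, RExp.cost, NExp.cost])).mono le_rfl fun _ _ h => h.1
  · have h14 : σ₂.real 14 0 = σ.real 14 0 := by
      rw [hF₂.real 14 (by simpa using ha'), hF₁.real 14 (by simpa using ha')]
    rcases hi.lt_or_eq with hi | rfl
    · have : ¬ σ.real 14 0 ≤ 2 ^ i := fun h => absurd (hn.2 h) (by lia)
      simpa [h₂, h14, hi] using this
    · simpa [h₂, h14] using hn.1
  · simp [ha, ha.symm, h₂, pow_succ, mul_two]

theorem runs_cumProg (h : Loaded D σ) :
    Runs ω cumProg σ (4 + (D.numEntries + 1) * 40)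
      fun σ' => ∀ e < D.numEntries, σ'.real 4 e = D.cum (e + 1) := by
  refine (Runs.seq (R := fun σ' => σ'.real 10 0 = 0) (Runs.of_wp (by simp)) fun σ₁ hF₁ h₁ =>
    Runs.forLoop (T := 14)
      (fun i σ' => σ'.real 10 0 = D.cum i ∧ ∀ e < i, σ'.real 4 e = D.cum (e + 1))
      D.numEntries rfl (fun σ₂ hF₂ => ?_) ?_ (fun i hi σ₂ hF₂ h₂ hi₂ => Runs.of_wp ?_)
      (by decide)).mono le_rfl fun _ _ h => h.2
  · simp [((h.frame hF₁).frame hF₂).numEntries]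
  · simp [h₁, TabularMDP.cum]
  · have hcum : D.cum i + D.P i = D.cum (i + 1) := (Finset.sum_range_succ _ _).symm
    refine ⟨by simp [hi₂, h₂.1, ((h.frame hF₁).frame hF₂).P, hcum], fun e he => ?_⟩
    rcases Nat.lt_succ_iff_lt_or_eq.1 he with he | rfl
    · simp [hi₂, he.ne, h₂.2 e he]
    · simp [hi₂, h₂.1, ((h.frame hF₁).frame hF₂).P, hcum]

theorem runs_nextProg (h : Loaded D σ) :
    Runs ω nextProg σ ((D.numPairs + 1) * 40 + (D.numEntries + 1) * 40)
      fun σ' => ∀ j < D.numPairs, σ'.real 5 j = D.next (σ.real 3) j := by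
  refine Runs.seq (Runs.forLoop (T := 5) (fun i σ' => ∀ j < i, σ'.real 5 j = 0) D.numPairs rfl
      (fun σ₁ hF₁ => ?_) (by simp) (fun i _ σ₁ _ h₁ hi₁ => Runs.of_wp fun j hj => ?_)
      (by decide)) fun σ₁ hF₁ h₁ =>
    Runs.forLoop (T := 20) (fun i σ' => ∀ j < D.numPairs, σ'.real 5 j =
        ∑ e ∈ Finset.range i with D.row e = j, D.P e * σ.real 3 (D.col e))
      D.numEntries rfl (fun σ₂ hF₂ => ?_) (by simpa using h₁)
      (fun i _ σ₂ hF₂ h₂ hi₂ => Runs.of_wp fun j hj => ?_) (by decide)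
  · simp [(h.frame hF₁).numPairs]
  · rcases Nat.lt_succ_iff_lt_or_eq.1 hj with hj | rfl
    · simp [hi₁, hj.ne, h₁ j hj]
    · simp [hi₁]
  · simp [((h.frame hF₁).frame hF₂).numEntries]
  · have hL := (h.frame hF₁).frame hF₂
    have h3 : σ₂.real 3 = σ.real 3 := by rw [hF₂.real 3 rfl, hF₁.real 3 rfl]
    rw [Finset.range_add_one, Finset.filter_insert]
    by_cases hij : D.row i = j
    · subst hij
      simp [hi₂, hL.row, hL.col, hL.P, h3, h₂ _ hj, add_comm]
    · simp [hi₂, hL.row, hij, Ne.symm hij, h₂ j hj]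

theorem runs_changeProg (h : Loaded D σ) :
    Runs ω changeProg σ ((D.numStates + 1) * 40 + (D.numPairs + 1) * 80)
      fun σ' => ∀ s < D.numStates, σ'.real 6 s =
        D.change (σ.real 7 0) (σ.real 3, σ.real 5) s := by
  refine Runs.seq (Runs.forLoop (T := 8) (fun i σ' => ∀ s < i, σ'.real 6 s = - σ.real 7 0)
      D.numStates rfl (fun σ₁ hF₁ => ?_) (by simp)
      (fun i hi σ₁ hF₁ h₁ hi₁ => Runs.of_wp fun s hs => ?_) (by decide)) fun σ₁ hF₁ h₁ =>
    Runs.forLoop (T := 55) (fun i σ' => ∀ s < D.numStates, σ'.real 6 s =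
        {j ∈ Finset.range i | D.st j = s}.fold max (- σ.real 7 0) fun j =>
          min (σ.real 7 0) (D.r j + D.γ * σ.real 5 j - σ.real 3 s))
      D.numPairs rfl (fun σ₂ hF₂ => ?_) (by simpa using h₁)
      (fun i _ σ₂ hF₂ h₂ hi₂ => Runs.of_wp ?_) (by decide)
  · simp [(h.frame hF₁).numStates]
  · rcases Nat.lt_succ_iff_lt_or_eq.1 hs with hs | rfl
    · simp [hi₁, hs.ne, h₁ s hs]
    · simp [hi₁, hF₁.real 7 rfl]
  · simp [((h.frame hF₁).frame hF₂).numPairs]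
  · have hL := (h.frame hF₁).frame hF₂
    have h3 : σ₂.real 3 = σ.real 3 := by rw [hF₂.real 3 rfl, hF₁.real 3 rfl]
    have h5 : σ₂.real 5 = σ.real 5 := by rw [hF₂.real 5 rfl, hF₁.real 5 rfl]
    have h7 : σ₂.real 7 = σ.real 7 := by rw [hF₂.real 7 rfl, hF₁.real 7 rfl]
    simp only [Prog.wp, Prog.wp_capReal, Prog.wp_raiseReal]
    intro s hs
    rw [Finset.range_add_one, Finset.filter_insert]
    by_cases his : D.st i = s
    · subst his
      simp [hi₂, hL.st, hL.r, hL.γ, h3, h5, h7, h₂ _ hs, max_comm, min_comm]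
    · simp [hi₂, hL.st, his, Ne.symm his, h₂ s hs]

theorem runs_addProg (h : Loaded D σ) :
    Runs ω addProg σ ((D.numStates + 1) * 40)
      fun σ' => ∀ s < D.numStates, σ'.real 3 s = σ.real 3 s + σ.real 6 s := by
  refine (Runs.forLoop (T := 10) (fun i σ' =>
      ∀ s, σ'.real 3 s = if s < i then σ.real 3 s + σ.real 6 s else σ.real 3 s)
    D.numStates rfl (fun σ₁ hF₁ => ?_) (by simp)
    (fun i _ σ₁ hF₁ h₁ hi₁ => Runs.of_wp fun s => ?_) (by decide)).mono le_rfl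
    fun _ _ H s hs => by rw [H s, if_pos hs]
  · simp [(h.frame hF₁).numStates]
  · rcases eq_or_ne s i with rfl | hs
    · simp [hi₁, h₁, hF₁.real 6 rfl]
    · simp [hi₁, h₁, hs, hs.le_iff_lt]

theorem runs_bisectProg (hcum : ∀ e < D.numEntries, σ.real 4 e = D.cum (e + 1)) {j : ℕ} {u : ℝ}
    (hj : σ.nat 5 0 = j) (hu : σ.real 8 0 = u)
    (hbr : D.IsBracket j u (σ.nat 8 0) (σ.nat 9 0)) {g : ℕ} (hg : D.numEntries ≤ 2 ^ g) :
    Runs ω bisectProg σ ((g + 1) * 50) fun σ' => σ'.nat 8 0 = D.sample j u := by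
  refine Runs.loop_of_measure (T := 36) (fun k σ' => σ'.nat 9 0 - σ'.nat 8 0 < 2 ^ k ∧
      D.IsBracket j u (σ'.nat 8 0) (σ'.nat 9 0)) (fun k σ₁ hF₁ h₁ hb => ?_)
    (fun k σ₁ _ h₁ hb => ?_) g ⟨by have := hbr.lt; lia, hbr⟩ (by decide)
  · obtain ⟨hlen, hbr₁⟩ := h₁
    have hlt : σ₁.nat 8 0 < σ₁.nat 9 0 := by simpa using hb
    obtain ⟨k, rfl⟩ : ∃ k', k = k' + 1 :=
      Nat.exists_eq_succ_of_ne_zero fun hk => by subst hk; lia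
    refine ⟨k, k.lt_succ_self, Runs.of_wp ?_⟩
    rw [pow_succ] at hlen
    set mid := (σ₁.nat 8 0 + σ₁.nat 9 0) / 2 with hmid
    have htest : (j + u ≤ σ₁.real 4 mid) ↔ j + u ≤ D.cum (mid + 1) := by
      rw [hF₁.real 4 rfl, hcum mid (by have := hbr₁.lt; lia)]
    constructor <;> intro hb'
    · have hcum' : j + u ≤ D.cum (mid + 1) := by
        simpa [← hmid, ← htest, hF₁.nat 5 rfl, hF₁.real 8 rfl, hj, hu] using hb'
      refine ⟨?_, ?_⟩
      · simp [← hmid]; lia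
      · simpa [← hmid] using hbr₁.lower_half (by lia) (by lia) hcum'
    · have hcum' : D.cum (mid + 1) < j + u := by
        simpa [← hmid, ← not_le, ← htest, hF₁.nat 5 rfl, hF₁.real 8 rfl, hj, hu] using hb'
      refine ⟨?_, ?_⟩
      · simp [← hmid]; lia
      · simpa [← hmid] using hbr₁.upper_half (by lia) hcum'
  · have heq : σ₁.nat 9 0 = σ₁.nat 8 0 := le_antisymm (by simpa using hb) h₁.2.le
    have hbr₁ := h₁.2
    rw [heq] at hbr₁
    exact hbr₁.sample_eq.symm

/-- The memory holds the process `D` and the partial sums of the entries of its transition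
matrix. -/
structure Prepared (D : TabularMDP) (σ : State) : Prop extends Loaded D σ where
  cum : ∀ e < D.numEntries, σ.real 4 e = D.cum (e + 1)

theorem Prepared.frame {p : Prog} (h : Prepared D σ) (hF : Frame p σ σ')
    (hn : ∀ a < 4, p.writesNat a = false := by decide)
    (hr : ∀ a < 3, p.writesReal a = false := by decide)
    (hr₄ : p.writesReal 4 = false := by decide) : Prepared D σ' :=
  ⟨h.toLoaded.frame hF hn hr, by simpa only [hF.real 4 hr₄] using h.cum⟩

theorem runs_sampleProg (h : Prepared D σ) (hu : σ.real 8 0 ≤ 1) {g : ℕ}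
    (hg : D.numEntries ≤ 2 ^ g) :
    Runs ω sampleProg σ ((D.numPairs + 1) * ((g + 2) * 50)) fun σ' => ∀ j < D.numPairs,
      σ'.real 5 j = σ.real 5 j + σ.real 6 (D.col (D.sample j (σ.real 8 0))) := by
  refine (Runs.forLoop (T := 12 + ((g + 1) * 50 + 16)) (fun i σ' => ∀ j, σ'.real 5 j =
      if j < i then σ.real 5 j + σ.real 6 (D.col (D.sample j (σ.real 8 0))) else σ.real 5 j)
    D.numPairs rfl (fun σ₁ hF₁ => ?_) (by simp) (fun i hi σ₁ hF₁ h₁ hi₁ => ?_) ?_).mono le_rfl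
    fun _ _ H j hj => by rw [H j, if_pos hj]
  · simp [(h.frame hF₁).numPairs]
  · have hP₁ := h.frame hF₁
    refine Runs.seq (R := fun σ' => σ'.nat 8 0 = 0 ∧ σ'.nat 9 0 = D.numEntries - 1)
      (Runs.of_wp (by simp [hP₁.numEntries])) fun σ₂ hF₂ h₂ => ?_
    have hbr : D.IsBracket i (σ.real 8 0) (σ₂.nat 8 0) (σ₂.nat 9 0) := by
      rw [h₂.1, h₂.2]
      exact .zero_pred hi hu
    have hP₂ := hP₁.frame hF₂
    refine (runs_bisectProg hP₂.cum (by rw [hF₂.nat 5 rfl, hi₁])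
      (by rw [hF₂.real 8 rfl, hF₁.real 8 rfl]) hbr hg).seq fun σ₃ hF₃ h₃ => Runs.of_wp fun j => ?_
    have h5 : σ₃.real 5 = σ₁.real 5 := by rw [hF₃.real 5 rfl, hF₂.real 5 rfl]
    have h6 : σ₃.real 6 = σ.real 6 := by rw [hF₃.real 6 rfl, hF₂.real 6 rfl, hF₁.real 6 rfl]
    have hi₃ : σ₃.nat 5 0 = i := by rw [hF₃.nat 5 rfl, hF₂.nat 5 rfl, hi₁]
    rcases eq_or_ne j i with rfl | hj
    · simp [hi₃, h₃, h5, h6, h₁, (hP₂.frame hF₃).col]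
    · simp [hi₃, h5, h₁, hj, hj.le_iff_lt]
  · simp only [size, RExp.cost, NExp.cost]
    lia

/-- The memory holds the values and the estimates `z`. -/
structure HoldsIterate (D : TabularMDP) (z : (ℕ → ℝ) × (ℕ → ℝ)) (σ : State) : Prop where
  value : ∀ s < D.numStates, σ.real 3 s = z.1 s
  estimate : ∀ j < D.numPairs, σ.real 5 j = z.2 j

/-- A bound for the running time of a round, if there are at most `2 ^ g` transitions. -/
def roundCost (D : TabularMDP) (g : ℕ) : ℕ :=
  (D.numStates + 1) * 100 + (D.numPairs + 1) * ((g + 4) * 50)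

theorem runs_roundProg (h : Prepared D σ) {z : (ℕ → ℝ) × (ℕ → ℝ)} (hz : HoldsIterate D z σ)
    {g : ℕ} (hg : D.numEntries ≤ 2 ^ g) :
    Runs ω roundProg σ (roundCost D g) fun σ' =>
      HoldsIterate D (D.round (σ.real 7 0) (ω σ.draws) z) σ' ∧ σ'.draws = σ.draws + 1 := by
  refine Runs.of_le ((runs_changeProg h.toLoaded).seq fun σ₁ hF₁ h₁ =>
    (runs_addProg (h.frame hF₁).toLoaded).seq fun σ₂ hF₂ h₂ =>
    Runs.seq (T := 2) (R := fun σ' => σ'.real 8 0 = (ω σ.draws : ℝ) ∧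
      σ'.draws = σ.draws + 1 ∧ ∀ a ≠ 8, σ'.real a = σ₂.real a)
      (Runs.of_wp ?_) fun σ₃ hF₃ h₃ =>
    (runs_sampleProg (((h.frame hF₁).frame hF₂).frame hF₃) ?_ hg).mono le_rfl
      fun σ₄ hF₄ h₄ => ?_) ?_
  · have hd : σ₂.draws = σ.draws := by rw [hF₂.draws rfl, hF₁.draws rfl]
    simpa [hd] using fun a ha => σ₂.writeReal_real_of_ne ha 0 _
  · simpa only [h₃.1] using (ω σ.draws).2.2
  · have hchange : ∀ s < D.numStates, σ₁.real 6 s = D.change (σ.real 7 0) z s := fun s hs => by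
      rw [h₁ s hs, TabularMDP.change_congr (hz.value s hs) hz.estimate]
    have h5 : σ₃.real 5 = σ.real 5 := by rw [hF₃.real 5 rfl, hF₂.real 5 rfl, hF₁.real 5 rfl]
    have h6 : σ₃.real 6 = σ₁.real 6 := by rw [hF₃.real 6 rfl, hF₂.real 6 rfl]
    refine ⟨⟨fun s hs => ?_, fun j hj => ?_⟩, by rw [hF₄.draws rfl, h₃.2.1]⟩
    · rw [hF₄.real 3 rfl, hF₃.real 3 rfl, h₂ s hs, hchange s hs, hF₁.real 3 rfl, hz.value s hs]
      rfl
    · have hs := D.col_lt _ (TabularMDP.sample_lt hj (ω σ.draws).2.2)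
      rw [h₄ j hj, h5, h6, h₃.1, hchange _ hs, hz.estimate j hj]
      rfl
  · rw [roundCost]
    lia

/-- A bound for the running time of an epoch of `L` rounds, if there are at most `2 ^ g`
transitions. -/
def epochCost (D : TabularMDP) (g L : ℕ) : ℕ :=
  (D.numPairs + 1) * 40 + (D.numEntries + 1) * 50 + (L + 1) * (roundCost D g + 20)

theorem runs_epochProg (h : Prepared D σ) {v : ℕ → ℝ} (hv : ∀ s < D.numStates, σ.real 3 s = v s)
    {L : ℕ} (hL : σ.real 13 0 = L) {g : ℕ} (hg : D.numEntries ≤ 2 ^ g) :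
    Runs ω epochProg σ (epochCost D g L) fun σ' =>
      σ'.real 7 0 = σ.real 7 0 / 2 ∧ σ'.draws = σ.draws + L ∧
        ∀ s < D.numStates, σ'.real 3 s = (D.rounds (σ.real 7 0) ω σ.draws v L).1 s := by
  refine Runs.of_le ((runs_nextProg h.toLoaded).seq fun σ₁ hF₁ h₁ =>
    (Runs.forLoop (T := roundCost D g) (T' := roundCost D g + 20)
      (fun i σ' => HoldsIterate D (D.rounds (σ.real 7 0) ω σ.draws v i) σ' ∧
        σ'.draws = σ.draws + i) L rfl (fun σ₂ hF₂ => ?_) ?_ (fun i _ σ₂ hF₂ h₂ _ => ?_) ?_).seq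
    fun σ₂ hF₂ h₂ => Runs.of_wp (T := 9) ?_) ?_
  · simp [hF₂.real 13 rfl, hF₁.real 13 rfl, hL]
  · refine ⟨⟨fun s hs => ?_, fun j hj => ?_⟩, hF₁.draws rfl⟩
    · rw [State.writeNat_real, hF₁.real 3 rfl, hv s hs]
      rfl
    · rw [State.writeNat_real, h₁ j hj]
      exact TabularMDP.next_congr hv j
  · have h7 : σ₂.real 7 = σ.real 7 := by rw [hF₂.real 7 rfl, hF₁.real 7 rfl]
    refine (runs_roundProg ((h.frame hF₁).frame hF₂) h₂.1 hg).mono le_rfl fun σ₃ _ h₃ => ?_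
    rw [h7, h₂.2] at h₃
    exact ⟨⟨h₃.1.value, h₃.1.estimate⟩, h₃.2⟩
  · simp only [scalar, RExp.cost, NExp.cost]
    lia
  · have h7 : σ₂.real 7 = σ.real 7 := by rw [hF₂.real 7 rfl, hF₁.real 7 rfl]
    simpa [h7, h₂.2] using h₂.1.value
  · rw [epochCost]
    lia

/-- The pair `p` belongs to the state `s` and is greedy, for the estimates `x`, among the pairs of
`s` before the pair `i`. -/
structure IsGreedyBelow (D : TabularMDP) (x : ℕ → ℝ) (i s p : ℕ) : Prop where
  lt : p < D.numPairs
  st_eq : D.st p = s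
  le : ∀ l < i, D.st l = s → D.r l + D.γ * x l ≤ D.r p + D.γ * x p

namespace IsGreedyBelow

variable {x x' : ℕ → ℝ} {i s p : ℕ}

theorem congr (h : IsGreedyBelow D x i s p) (hi : i ≤ D.numPairs)
    (hx : ∀ j < D.numPairs, x j = x' j) : IsGreedyBelow D x' i s p :=
  ⟨h.lt, h.st_eq, fun l hl hs => by
    simpa only [hx l (hl.trans_le hi), hx p h.lt] using h.le l hl hs⟩

theorem succ (h : IsGreedyBelow D x i s p)
    (hle : D.st i = s → D.r i + D.γ * x i ≤ D.r p + D.γ * x p) :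
    IsGreedyBelow D x (i + 1) s p := by
  refine ⟨h.lt, h.st_eq, fun l hl hs => ?_⟩
  rcases Nat.lt_succ_iff_lt_or_eq.1 hl with hl | rfl
  exacts [h.le l hl hs, hle hs]

theorem succ_self (h : IsGreedyBelow D x i (D.st i) p) (hi : i < D.numPairs)
    (hle : D.r p + D.γ * x p ≤ D.r i + D.γ * x i) :
    IsGreedyBelow D x (i + 1) (D.st i) i := by
  refine ⟨hi, rfl, fun l hl hs => ?_⟩
  rcases Nat.lt_succ_iff_lt_or_eq.1 hl with hl | rfl
  exacts [(h.le l hl hs).trans hle, le_rfl]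

end IsGreedyBelow

theorem runs_greedyProg (h : Loaded D σ) :
    Runs ω greedyProg σ ((D.numPairs + 1) * 150 + (D.numEntries + 1) * 40) fun σ' =>
      ∀ j < D.numPairs,
        IsGreedyBelow D (D.next (σ.real 3)) D.numPairs (D.st j) (σ'.nat 4 (D.st j)) := by
  refine Runs.of_le ((runs_nextProg h).seq fun σ₁ hF₁ h₁ =>
    (Runs.forLoop (T := 10) (fun i σ' => ∀ j < i,
        IsGreedyBelow D (σ₁.real 5) 0 (D.st j) (σ'.nat 4 (D.st j)))
      D.numPairs rfl (fun σ₂ hF₂ => ?_) (by simp) (fun i hi σ₂ hF₂ h₂ hi₂ => Runs.of_wp ?_)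
      le_rfl).seq fun σ₂ hF₂ h₂ =>
    (Runs.forLoop (T := 40) (fun i σ' => ∀ j < D.numPairs,
        IsGreedyBelow D (σ₁.real 5) i (D.st j) (σ'.nat 4 (D.st j)))
      D.numPairs rfl (fun σ₃ hF₃ => ?_) (by simpa using h₂)
      (fun i hi σ₃ hF₃ h₃ hi₃ => Runs.of_wp ?_) le_rfl).mono le_rfl
    fun _ _ h₃ j hj => (h₃ j hj).congr le_rfl h₁) ?_
  · simp [((h.frame hF₁).frame hF₂).numPairs]
  · intro j hj
    have hst : σ₂.nat 1 = D.st := ((h.frame hF₁).frame hF₂).st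
    by_cases hij : D.st j = D.st i
    · simpa [hi₂, hst, hij] using ⟨hi, rfl, by simp⟩
    · have hji : j < i := (Nat.lt_succ_iff.1 hj).lt_of_ne fun h => hij (h ▸ rfl)
      simpa [hi₂, hst, hij] using h₂ j hji
  · simp [(((h.frame hF₁).frame hF₂).frame hF₃).numPairs]
  · have hL := ((h.frame hF₁).frame hF₂).frame hF₃
    have h5 : σ₃.real 5 = σ₁.real 5 := by rw [hF₃.real 5 rfl, hF₂.real 5 rfl]
    refine ⟨fun hb j hj => ?_, fun hb j hj => ?_⟩
    · by_cases hij : D.st j = D.st i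
      · simpa [hi₃, hL.st, hij] using (h₃ i hi).succ_self hi
          (by simpa [hi₃, hL.st, hL.r, hL.γ, h5] using hb)
      · simpa [hi₃, hL.st, hij] using (h₃ j hj).succ fun his => absurd his.symm hij
    · have hlt : D.r i + D.γ * σ₁.real 5 i < D.r (σ₃.nat 4 (D.st i)) +
          D.γ * σ₁.real 5 (σ₃.nat 4 (D.st i)) := by
        simpa [hi₃, hL.st, hL.r, hL.γ, h5] using hb
      simpa using (h₃ j hj).succ fun his => his ▸ hlt.le
  · simp [RExp.cost, NExp.cost]
    lia

/-- The numbers that the program computes first: a bound `N` for `(1 - γ)⁻¹`, the number `K` of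
epochs, and a number `c` for which `2 * exp (-2 * c)` bounds the failure probability of a single
estimate. -/
structure IsParam (D : TabularMDP) (ε δ : ℝ) (N K c : ℕ) : Prop where
  horizon : IsLeast {n : ℕ | 0 < n ∧ 1 ≤ n * (1 - D.γ)} N
  epochs : IsLeast {k : ℕ | 2 * (N * N) / ε ≤ (2 : ℝ) ^ k} K
  logFactor : IsLeast {k : ℕ | 32 * (K + 1) * (N * N * D.numPairs) / δ ≤ (2 : ℝ) ^ k} c

/-- The number of rounds of an epoch. -/
def epochLength (N c : ℕ) : ℕ := 16 * (N * N * c)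

/-- The truncation width in the first epoch. -/
noncomputable def initialWidth (N c : ℕ) : ℝ := 1 / (32 * (N * c))

theorem runs_paramProg (h : Loaded D σ) {N K c : ℕ}
    (H : IsParam D (σ.real 0 1) (σ.real 0 2) N K c) :
    Runs ω paramProg σ ((N + K + c) * 20 + 150) fun σ' =>
      σ'.real 11 0 = K ∧ σ'.real 13 0 = epochLength N c ∧ σ'.real 7 0 = initialWidth N c := by
  refine Runs.of_le ((runs_horizonProg (by simpa [h.γ] using H.horizon)).seq fun σ₁ hF₁ h₁ =>
    Runs.seq (T := 20) (R := fun σ' => σ'.real 14 0 = 2 * (N * N) / σ.real 0 1)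
      (Runs.of_wp ?_) fun σ₂ hF₂ h₂ =>
    (runs_logProg (by decide) (by decide) (by simpa [h₂] using H.epochs)).seq fun σ₃ hF₃ h₃ =>
    Runs.seq (T := 30) (R := fun σ' => σ'.real 14 0 =
      32 * (K + 1) * (N * N * D.numPairs) / σ.real 0 2) (Runs.of_wp ?_) fun σ₄ hF₄ h₄ =>
    (runs_logProg (by decide) (by decide) (by simpa [h₄] using H.logFactor)).seq
      fun σ₅ hF₅ h₅ => Runs.of_wp (T := 40) ?_) ?_
  · simp [h₁, hF₁.real 0 rfl]
  · have h0 : σ₃.real 0 = σ.real 0 := by rw [hF₃.real 0 rfl, hF₂.real 0 rfl, hF₁.real 0 rfl]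
    have h9 : σ₃.real 9 0 = N := by rw [hF₃.real 9 rfl, hF₂.real 9 rfl, h₁]
    simp [h0, h9, h₃, (((h.frame hF₁).frame hF₂).frame hF₃).numPairs]
  · have h9 : σ₅.real 9 0 = N := by
      rw [hF₅.real 9 rfl, hF₄.real 9 rfl, hF₃.real 9 rfl, hF₂.real 9 rfl, h₁]
    have h11 : σ₅.real 11 0 = K := by rw [hF₅.real 11 rfl, hF₄.real 11 rfl, h₃]
    simp [h9, h11, h₅, epochLength, initialWidth]
  · lia

/-- A bound for the running time of the program, if there are at most `2 ^ g` transitions. -/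
def totalCost (D : TabularMDP) (g N K c : ℕ) : ℕ :=
  (N + K + c) * 20 + (D.numPairs + 1) * 150 + (D.numEntries + 1) * 80 + 154 +
    (K + 1) * (epochCost D g (epochLength N c) + 20)

theorem runs_mainProg (h : Loaded D σ) (hv : σ.real 3 = 0) (hd : σ.draws = 0) {N K c : ℕ}
    (H : IsParam D (σ.real 0 1) (σ.real 0 2) N K c) {g : ℕ} (hg : D.numEntries ≤ 2 ^ g) :
    Runs ω mainProg σ (totalCost D g N K c) fun σ' =>
      (∀ s < D.numStates,
        σ'.real 3 s = D.epochs (initialWidth N c) (epochLength N c) ω K s) ∧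
      ∀ j < D.numPairs,
        IsGreedyBelow D (D.next (σ'.real 3)) D.numPairs (D.st j) (σ'.nat 4 (D.st j)) := by
  refine Runs.of_le ((runs_paramProg h H).seq fun σ₁ hF₁ h₁ =>
    (runs_cumProg (h.frame hF₁)).seq fun σ₂ hF₂ h₂ =>
    (Runs.forLoop (T := epochCost D g (epochLength N c))
      (fun k σ' => σ'.real 7 0 = initialWidth N c / 2 ^ k ∧ σ'.draws = k * epochLength N c ∧
        ∀ s < D.numStates, σ'.real 3 s = D.epochs (initialWidth N c) (epochLength N c) ω k s)
      K rfl (fun σ₃ hF₃ => ?_) ?_ (fun k _ σ₃ hF₃ h₃ _ => ?_) le_rfl).seq fun σ₃ hF₃ h₃ =>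
    (runs_greedyProg ((((h.frame hF₁).frame hF₂)).frame hF₃)).mono le_rfl
      fun σ₄ hF₄ h₄ => ?_) ?_
  · simp [hF₃.real 11 rfl, hF₂.real 11 rfl, h₁.1]
  · simp [hF₂.real 7 rfl, hF₂.real 3 rfl, hF₁.real 3 rfl, hF₂.draws rfl, hF₁.draws rfl, h₁.2.2,
      hv, hd, TabularMDP.epochs]
  · have hP : Prepared D σ₃ := Prepared.frame ⟨(h.frame hF₁).frame hF₂, h₂⟩ hF₃
    have hL : σ₃.real 13 0 = epochLength N c := by rw [hF₃.real 13 rfl, hF₂.real 13 rfl, h₁.2.1]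
    refine (runs_epochProg hP h₃.2.2 hL hg).mono le_rfl fun σ₄ _ h₄ => ?_
    rw [h₃.1, h₃.2.1] at h₄
    refine ⟨?_, ?_, h₄.2.2⟩
    · rw [State.writeNat_real, h₄.1, pow_succ, div_div]
    · exact h₄.2.1.trans (Nat.succ_mul _ _).symm
  · have h3 : σ₄.real 3 = σ₃.real 3 := hF₄.real 3 rfl
    rw [h3]
    exact ⟨h₃.2.2, h₄⟩
  · simp only [totalCost, scalar, RExp.cost, NExp.cost]
    lia

section Parameters

variable {x Y ε δ : ℝ} {n p N K c g : ℕ}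

theorem exists_isLeast_le_two_pow (x : ℝ) : ∃ n, IsLeast {k : ℕ | x ≤ (2 : ℝ) ^ k} n := by
  obtain ⟨k, hk⟩ := pow_unbounded_of_one_lt x one_lt_two
  exact ⟨_, Nat.sInf_mem ⟨k, hk.le⟩, fun _ => Nat.sInf_le⟩

theorem two_pow_le_of_isLeast (h : IsLeast {k : ℕ | x ≤ (2 : ℝ) ^ k} n) :
    (2 : ℝ) ^ n ≤ max 1 (2 * x) := by
  cases n with
  | zero => simp
  | succ n =>
    have hn : (2 : ℝ) ^ n < x := not_le.1 fun hx => (h.2 hx).not_gt n.lt_succ_self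
    exact le_max_of_le_right (by rw [pow_succ]; linarith)

theorem le_log_of_two_pow_le (h : (2 : ℝ) ^ n ≤ Y ^ p) : n ≤ 2 * p * Real.log Y := by
  have hlog : n * Real.log 2 ≤ p * Real.log Y := by
    simpa only [Real.log_pow] using Real.log_le_log (by positivity) h
  have htwo : n * (1 / 2) ≤ n * Real.log 2 := by
    gcongr
    linarith [Real.log_two_gt_d9]
  linarith

theorem exists_isParam (D : TabularMDP) (ε δ : ℝ) : ∃ N K c, IsParam D ε δ N K c := by
  have hγ : 0 < 1 - D.γ := sub_pos.2 D.γ_lt_one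
  obtain ⟨N, hN⟩ : ∃ N, IsLeast {n : ℕ | 0 < n ∧ 1 ≤ n * (1 - D.γ)} N := by
    obtain ⟨n, hn⟩ := exists_nat_ge (1 / (1 - D.γ))
    exact ⟨_, Nat.sInf_mem ⟨n, Nat.cast_pos.1 ((one_div_pos.2 hγ).trans_le hn),
      (div_le_iff₀ hγ).1 hn⟩, fun _ => Nat.sInf_le⟩
  obtain ⟨K, hK⟩ := exists_isLeast_le_two_pow (2 * (N * N) / ε)
  obtain ⟨c, hc⟩ := exists_isLeast_le_two_pow (32 * (K + 1) * (N * N * D.numPairs) / δ)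
  exact ⟨N, K, c, hN, hK, hc⟩

/-- The argument of the logarithm in the running time. -/
noncomputable def problemSize (D : TabularMDP) (ε δ : ℝ) : ℝ :=
  2 + D.numPairs + ε⁻¹ + (1 - D.γ)⁻¹ + δ⁻¹

theorem one_le_inv_one_sub_γ (D : TabularMDP) : 1 ≤ (1 - D.γ)⁻¹ :=
  (one_le_inv₀ (sub_pos.2 D.γ_lt_one)).2 (by linarith [D.γ_nonneg])

theorem problemSize_bounds (hA : 0 < D.numPairs) (hε : 0 < ε) (hδ : 0 < δ) :
    4 ≤ problemSize D ε δ ∧ D.numPairs ≤ problemSize D ε δ ∧ ε⁻¹ ≤ problemSize D ε δ ∧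
      (1 - D.γ)⁻¹ + 1 ≤ problemSize D ε δ ∧ δ⁻¹ ≤ problemSize D ε δ := by
  have hA' : (1 : ℝ) ≤ D.numPairs := by exact_mod_cast hA
  have hε' := inv_pos.2 hε
  have hδ' := inv_pos.2 hδ
  have hG := one_le_inv_one_sub_γ D
  unfold problemSize
  refine ⟨?_, ?_, ?_, ?_, ?_⟩ <;> linarith

theorem one_le_log_problemSize (hA : 0 < D.numPairs) (hε : 0 < ε) (hδ : 0 < δ) :
    1 ≤ Real.log (problemSize D ε δ) := by
  have hY := (problemSize_bounds hA hε hδ).1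
  rw [Real.le_log_iff_exp_le (by linarith)]
  linarith [Real.exp_one_lt_d9]

theorem numEntries_log_le (hg : IsLeast {k : ℕ | (D.numEntries : ℝ) ≤ (2 : ℝ) ^ k} g)
    (hA : 0 < D.numPairs) (hS : D.numStates ≤ D.numPairs)
    (hE : D.numEntries ≤ D.numPairs * D.numStates) (hε : 0 < ε) (hδ : 0 < δ) :
    g ≤ 6 * Real.log (problemSize D ε δ) := by
  obtain ⟨hY, hAY, -⟩ := problemSize_bounds hA hε hδ
  have hE' : (D.numEntries : ℝ) ≤ problemSize D ε δ * problemSize D ε δ := calc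
    (D.numEntries : ℝ) ≤ D.numPairs * D.numPairs := by
      exact_mod_cast hE.trans (Nat.mul_le_mul_left _ hS)
    _ ≤ _ := by gcongr
  have hpow : (2 : ℝ) ^ g ≤ problemSize D ε δ ^ 3 := by
    refine (two_pow_le_of_isLeast hg).trans (max_le (one_le_pow₀ (by linarith)) ?_)
    nlinarith
  exact (le_log_of_two_pow_le hpow).trans_eq (by norm_num)

namespace IsParam

variable (H : IsParam D ε δ N K c)

include H

theorem one_le_horizon : (1 : ℝ) ≤ N := by exact_mod_cast H.horizon.1.1

theorem horizon_le : N ≤ (1 - D.γ)⁻¹ + 1 := by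
  have hγ : 0 < 1 - D.γ := sub_pos.2 D.γ_lt_one
  by_contra! hlt
  obtain ⟨n, rfl⟩ : ∃ n, N = n + 1 := ⟨N - 1, by have := H.horizon.1.1; omega⟩
  push_cast at hlt
  have hn : (1 - D.γ)⁻¹ < n := by linarith
  have hmem : 0 < n ∧ 1 ≤ n * (1 - D.γ) :=
    ⟨Nat.cast_pos.1 ((inv_pos.2 hγ).trans hn), ((inv_lt_iff_one_lt_mul₀ hγ).1 hn).le⟩
  exact (H.horizon.2 hmem).not_gt n.lt_succ_self

theorem horizon_le_problemSize (hA : 0 < D.numPairs) (hε : 0 < ε) (hδ : 0 < δ) :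
    N ≤ problemSize D ε δ :=
  H.horizon_le.trans (problemSize_bounds hA hε hδ).2.2.2.1

theorem two_pow_epochs_le (hA : 0 < D.numPairs) (hε : 0 < ε) (hδ : 0 < δ) :
    (2 : ℝ) ^ K ≤ problemSize D ε δ ^ 4 := by
  obtain ⟨hY, -, hεY, -⟩ := problemSize_bounds hA hε hδ
  have hN := H.horizon_le_problemSize hA hε hδ
  set Y := problemSize D ε δ
  refine (two_pow_le_of_isLeast H.epochs).trans (max_le (one_le_pow₀ (by linarith)) ?_)
  calc 2 * (2 * ((N : ℝ) * N) / ε) = 4 * N * N * ε⁻¹ := by ring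
    _ ≤ Y * Y * Y * Y := by gcongr
    _ = Y ^ 4 := by ring

theorem epochs_le (hA : 0 < D.numPairs) (hε : 0 < ε) (hδ : 0 < δ) :
    K ≤ 8 * Real.log (problemSize D ε δ) :=
  (le_log_of_two_pow_le (H.two_pow_epochs_le hA hε hδ)).trans_eq (by norm_num)

theorem logFactor_le (hA : 0 < D.numPairs) (hε : 0 < ε) (hδ : 0 < δ) :
    c ≤ 22 * Real.log (problemSize D ε δ) := by
  obtain ⟨hY, hAY, -, -, hδY⟩ := problemSize_bounds hA hε hδ
  have hN := H.horizon_le_problemSize hA hε hδ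
  have hK : (K : ℝ) + 1 ≤ problemSize D ε δ ^ 4 :=
    le_trans (by exact_mod_cast K.lt_two_pow_self) (H.two_pow_epochs_le hA hε hδ)
  set Y := problemSize D ε δ
  have h64 : 64 ≤ Y ^ 3 := by
    calc (64 : ℝ) = 4 ^ 3 := by norm_num
      _ ≤ Y ^ 3 := by gcongr
  have hpow : (2 : ℝ) ^ c ≤ Y ^ 11 := by
    refine (two_pow_le_of_isLeast H.logFactor).trans (max_le (one_le_pow₀ (by linarith)) ?_)
    calc 2 * (32 * ((K : ℝ) + 1) * (N * N * D.numPairs) / δ)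
        = 64 * (K + 1) * (N * N * D.numPairs) * δ⁻¹ := by ring
      _ ≤ Y ^ 3 * Y ^ 4 * (Y * Y * Y) * Y := by gcongr
      _ = Y ^ 11 := by ring
  exact (le_log_of_two_pow_le hpow).trans_eq (by norm_num)

theorem logFactor_pos (hA : 0 < D.numPairs) (hδ : 0 < δ) (hδ1 : δ < 1) : 0 < c := by
  refine Nat.pos_of_ne_zero fun hc => ?_
  have hle : 32 * ((K : ℝ) + 1) * (N * N * D.numPairs) ≤ δ := by
    simpa [hc, div_le_iff₀ hδ] using H.logFactor.1
  have hA' : (1 : ℝ) ≤ D.numPairs := by exact_mod_cast hA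
  have hNNA : 1 ≤ (N : ℝ) * N * D.numPairs :=
    one_le_mul_of_one_le_of_one_le
      (one_le_mul_of_one_le_of_one_le H.one_le_horizon H.one_le_horizon) hA'
  nlinarith [K.cast_nonneg (α := ℝ)]

theorem epochLength_succ_le (hA : 0 < D.numPairs) (hε : 0 < ε) (hδ : 0 < δ) :
    (epochLength N c : ℝ) + 1 ≤
      1409 * (1 - D.γ)⁻¹ ^ 2 * Real.log (problemSize D ε δ) := by
  have hG := one_le_inv_one_sub_γ D
  have hN : (N : ℝ) ≤ 2 * (1 - D.γ)⁻¹ := by linarith [H.horizon_le]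
  have hc := H.logFactor_le hA hε hδ
  have hl := one_le_log_problemSize hA hε hδ
  set G := (1 - D.γ)⁻¹
  set l := Real.log (problemSize D ε δ)
  calc (epochLength N c : ℝ) + 1 = 16 * (N * N * c) + 1 * 1 := by simp [epochLength]
    _ ≤ 16 * (2 * G * (2 * G) * (22 * l)) + G ^ 2 * l := by
        gcongr
        exact one_le_pow₀ hG
    _ = 1409 * G ^ 2 * l := by ring

end IsParam

theorem roundCost_le {l : ℝ} (hl : 1 ≤ l) (hg : g ≤ 6 * l) (hA : 0 < D.numPairs)
    (hS : D.numStates ≤ D.numPairs) : (roundCost D g : ℝ) + 20 ≤ 1220 * D.numPairs * l := by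
  have hA' : (1 : ℝ) ≤ D.numPairs := by exact_mod_cast hA
  have hS' : (D.numStates : ℝ) ≤ D.numPairs := by exact_mod_cast hS
  have hAl : (D.numPairs : ℝ) ≤ D.numPairs * l := le_mul_of_one_le_right (by positivity) hl
  calc (roundCost D g : ℝ) + 20
      = (D.numStates + 1) * 100 + (D.numPairs + 1) * ((g + 4) * 50) + 20 := by simp [roundCost]
    _ ≤ (D.numPairs + D.numPairs) * 100 + (D.numPairs + D.numPairs) * ((6 * l + 4 * l) * 50) +
          20 * D.numPairs := by gcongr <;> linarith
    _ ≤ 1220 * D.numPairs * l := by linarith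

theorem epochCost_le {L : ℕ} {G l : ℝ} (hG : 1 ≤ G) (hl : 1 ≤ l) (hg : g ≤ 6 * l)
    (hL : L + 1 ≤ 1409 * G ^ 2 * l) (hA : 0 < D.numPairs) (hS : D.numStates ≤ D.numPairs) :
    (epochCost D g L : ℝ) ≤ 2 * 10 ^ 6 * (D.numEntries + D.numPairs * G ^ 2) * l ^ 2 := by
  have hA' : (1 : ℝ) ≤ D.numPairs := by exact_mod_cast hA
  have hl2 : 1 ≤ l ^ 2 := one_le_pow₀ hl
  have hAG : (D.numPairs : ℝ) ≤ D.numPairs * G ^ 2 :=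
    le_mul_of_one_le_right (by positivity) (one_le_pow₀ hG)
  have hAGl : D.numPairs * G ^ 2 ≤ D.numPairs * G ^ 2 * l ^ 2 :=
    le_mul_of_one_le_right (by positivity) hl2
  have hEl : (D.numEntries : ℝ) ≤ D.numEntries * l ^ 2 :=
    le_mul_of_one_le_right (by positivity) hl2
  calc (epochCost D g L : ℝ)
      = (D.numPairs + 1) * 40 + (D.numEntries + 1) * 50 + (L + 1) * (roundCost D g + 20) := by
        simp [epochCost]
    _ ≤ (D.numPairs + 1) * 40 + (D.numEntries + 1) * 50 +
          1409 * G ^ 2 * l * (1220 * D.numPairs * l) := by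
        gcongr
        exact roundCost_le hl hg hA hS
    _ ≤ 2 * 10 ^ 6 * (D.numEntries + D.numPairs * G ^ 2) * l ^ 2 := by linarith

theorem IsParam.totalCost_le (H : IsParam D ε δ N K c)
    (hg : IsLeast {k : ℕ | (D.numEntries : ℝ) ≤ (2 : ℝ) ^ k} g) (hA : 0 < D.numPairs)
    (hS : D.numStates ≤ D.numPairs) (hE : D.numEntries ≤ D.numPairs * D.numStates)
    (hε : 0 < ε) (hδ : 0 < δ) :
    (totalCost D g N K c : ℝ) ≤ 2 * 10 ^ 7 * (D.numEntries + D.numPairs * (1 - D.γ)⁻¹ ^ 2) *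
      Real.log (problemSize D ε δ) ^ 3 := by
  have hA' : (1 : ℝ) ≤ D.numPairs := by exact_mod_cast hA
  have hG := one_le_inv_one_sub_γ D
  have hl := one_le_log_problemSize hA hε hδ
  have hN := H.horizon_le
  have hK := H.epochs_le hA hε hδ
  have hc := H.logFactor_le hA hε hδ
  have hepoch := epochCost_le hG hl (numEntries_log_le hg hA hS hE hε hδ)
    (H.epochLength_succ_le hA hε hδ) hA hS
  set G := (1 - D.γ)⁻¹
  set l := Real.log (problemSize D ε δ)
  set B : ℝ := D.numEntries + D.numPairs * G ^ 2 with hB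
  have hGG : G ≤ G ^ 2 := le_self_pow₀ hG two_ne_zero
  have hGB : G ^ 2 ≤ D.numPairs * G ^ 2 := le_mul_of_one_le_left (by positivity) hA'
  have hAB : (D.numPairs : ℝ) ≤ D.numPairs * G ^ 2 :=
    le_mul_of_one_le_right (by positivity) (one_le_pow₀ hG)
  have hl3 : l ≤ l ^ 3 := le_self_pow₀ hl three_ne_zero
  have hBl : B ≤ B * l ^ 3 := le_mul_of_one_le_right (by positivity) (hl.trans hl3)
  have hlB : l ^ 3 ≤ B * l ^ 3 := le_mul_of_one_le_left (by positivity) (by linarith)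
  calc (totalCost D g N K c : ℝ)
      = (N + K + c) * 20 + (D.numPairs + 1) * 150 + (D.numEntries + 1) * 80 + 154 +
          (K + 1) * (epochCost D g (epochLength N c) + 20) := by simp [totalCost]
    _ ≤ (N + K + c) * 20 + (D.numPairs + 1) * 150 + (D.numEntries + 1) * 80 + 154 +
          (8 * l + l) * (2 * 10 ^ 6 * B * l ^ 2 + 20) := by gcongr
    _ ≤ 2 * 10 ^ 7 * B * l ^ 3 := by linarith [hB]

end Parameters

theorem IsParam.abs_epochs_sub_le {ε δ : ℝ} {N K c : ℕ} (H : IsParam D ε δ N K c) (hε : 0 < ε)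
    (hc : 0 < c) {u : ℕ → ℝ} (hu : D.SolvesBellman u)
    (hu₀ : ∀ s < D.numStates, |u s| ≤ 1 / (1 - D.γ))
    (herr : D.EstimatesAccurate (initialWidth N c) (8 * N * c) (epochLength N c) K ω) {s : ℕ}
    (hs : s < D.numStates) :
    |D.epochs (initialWidth N c) (epochLength N c) ω K s - u s| ≤ ε * (1 - D.γ) / 2 := by
  have hγ : 0 < 1 - D.γ := sub_pos.2 D.γ_lt_one
  have hN := H.one_le_horizon
  have hc' : (1 : ℝ) ≤ c := by exact_mod_cast hc
  have hNγ := H.horizon.1.2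
  have hwidth : 4 * N * (8 * N * c * initialWidth N c) = N := by
    rw [initialWidth]
    field_simp
    norm_num
  have hbound := D.abs_epochs_sub_le hu hNγ (h := initialWidth N c) (m := 8 * N * c)
    (by unfold initialWidth; positivity) (by nlinarith) (by push_cast [epochLength]; ring)
    (fun s hs => by
      rw [hwidth]
      exact (hu₀ s hs).trans ((div_le_iff₀ hγ).2 hNγ)) herr hs
  rw [hwidth] at hbound
  refine hbound.trans ?_
  rw [div_le_iff₀ (by positivity)]
  have hK : 2 * (N * N) ≤ ε * 2 ^ K := by
    simpa [div_le_iff₀ hε, mul_comm] using H.epochs.1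
  calc (N : ℝ) ≤ N * (N * (1 - D.γ)) := le_mul_of_one_le_right (by positivity) hNγ
    _ = 2 * (N * N) * ((1 - D.γ) / 2) := by ring
    _ ≤ ε * 2 ^ K * ((1 - D.γ) / 2) := by gcongr
    _ = ε * (1 - D.γ) / 2 * 2 ^ K := by ring

theorem IsParam.measure_not_estimatesAccurate_le {ε δ : ℝ} {N K c : ℕ} (H : IsParam D ε δ N K c)
    (hδ : 0 < δ) (hc : 0 < c) :
    tapeMeasure {ω | ¬ D.EstimatesAccurate (initialWidth N c) (8 * N * c) (epochLength N c) K ω} ≤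
      ENNReal.ofReal δ := by
  have hN := H.one_le_horizon
  have hNNA : 0 ≤ (N : ℝ) * N * D.numPairs := by positivity
  have htwo : (2 : ℝ) ^ c ≤ Real.exp c := by
    rw [← Real.exp_one_pow]
    exact pow_le_pow_left₀ two_pos.le (by linarith [Real.add_one_le_exp 1]) c
  have hunion : 32 * K * (N * N * D.numPairs) ≤ δ * Real.exp c := by
    have := (div_le_iff₀' hδ).1 (H.logFactor.1.trans htwo)
    linarith
  have hwidth : 0 < initialWidth N c := by
    unfold initialWidth
    positivity
  refine (TabularMDP.measure_not_estimatesAccurate_le (c := 2 * c) hwidth (by positivity)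
    (by push_cast [epochLength]; linarith) K).trans (ENNReal.ofReal_le_ofReal ?_)
  have hexp : Real.exp (-(2 * c)) = (Real.exp c * Real.exp c)⁻¹ := by
    rw [← Real.exp_add, Real.exp_neg]
    ring_nf
  calc K * (epochLength N c : ℝ) * D.numPairs * (2 * Real.exp (-(2 * c)))
      = 32 * K * (N * N * D.numPairs) * c * (Real.exp c * Real.exp c)⁻¹ := by
        rw [hexp]
        push_cast [epochLength]
        ring
    _ ≤ δ * Real.exp c * Real.exp c * (Real.exp c * Real.exp c)⁻¹ := by
        gcongr
        linarith [Real.add_one_le_exp (c : ℝ)]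
    _ = δ := by field_simp

section Numbering

variable {S : Type} [Fintype S] {A : S → Type} [∀ s, Fintype (A s)] {M : DMDP S A}

theorem loaded_input (I : M.Numbering) (ε δ : ℝ) : Loaded I.toTabular (I.input ε δ) := by
  constructor <;> rfl

theorem IsGreedyBelow.exists_action {I : M.Numbering} {v : ℕ → ℝ} {s : S} {p : ℕ}
    (h : IsGreedyBelow I.toTabular (I.toTabular.next v) M.numPairs (I.state.symm s) p) :
    ∃ a, p = I.pair.symm ⟨s, a⟩ ∧ ∀ b, M.qValue (fun s => v (I.state.symm s)) ⟨s, b⟩ ≤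
      M.qValue (fun s => v (I.state.symm s)) ⟨s, a⟩ := by
  obtain ⟨⟨s', a⟩, rfl⟩ : ∃ q, p = I.pair.symm q := ⟨I.pair ⟨p, h.lt⟩, by simp⟩
  obtain rfl : s' = s := by
    simpa [DMDP.Numbering.toTabular, DMDP.Numbering.st, ← Fin.ext_iff] using h.st_eq
  refine ⟨a, rfl, fun b => ?_⟩
  simpa only [I.toTabular_backup, Equiv.apply_symm_apply] using
    h.le (I.pair.symm ⟨s', b⟩) (Fin.is_lt _) (by simp [DMDP.Numbering.toTabular, DMDP.Numbering.st])

variable [∀ s, Nonempty (A s)]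

theorem isEpsOptimalOutput (I : M.Numbering) {ε : ℝ} (hε : 0 ≤ ε)
    (hv : ∀ s < M.numStates, |σ.real 3 s - I.tabulate M.optValue s| ≤ ε * (1 - M.γ) / 2)
    (hgreedy : ∀ j < M.numPairs, IsGreedyBelow I.toTabular (I.toTabular.next (σ.real 3))
      M.numPairs (I.st j) (σ.nat 4 (I.st j))) :
    I.IsEpsOptimalOutput ε σ := by
  have hv' : ∀ s, |σ.real 3 (I.state.symm s) - M.optValue s| ≤ ε * (1 - M.γ) / 2 := fun s => by
    simpa only [I.tabulate_symm] using hv (I.state.symm s) (Fin.is_lt _)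
  have hgreedy' : ∀ s, IsGreedyBelow I.toTabular (I.toTabular.next (σ.real 3)) M.numPairs
      (I.state.symm s) (σ.nat 4 (I.state.symm s)) := fun s => by
    simpa [DMDP.Numbering.st] using
      hgreedy (I.pair.symm ⟨s, Classical.arbitrary _⟩) (Fin.is_lt _)
  choose π hπ hbest using fun s => (hgreedy' s).exists_action
  refine ⟨⟨π, M.isEpsOptimalPolicy_of_greedy hv' (by linarith) π hbest, hπ⟩,
    (pi_norm_le_iff_of_nonneg hε).2 fun s => (hv' s).trans ?_⟩
  linarith [mul_nonneg hε M.γ_nonneg]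

end Numbering

end ValueIteration

open ValueIteration RealRAM in
theorem theorem1p2 :
    ∃ (p : RealRAM.Prog) (C : ℝ) (k : ℕ),
      ∀ (S : Type) [Fintype S] [Nonempty S] (A : S → Type) [∀ s, Fintype (A s)]
        [∀ s, Nonempty (A s)] (M : DMDP S A) (I : M.Numbering) (ε δ : ℝ),
        0 < ε → 0 < δ → δ < 1 →
        (∀ ω : RealRAM.Tape, ∃ (t : ℕ) (σ : RealRAM.State),
          RealRAM.Exec ω p (I.input ε δ) t σ ∧
          (t : ℝ) ≤ C * ((M.nnz : ℝ) + (M.numPairs : ℝ) * (1 - M.γ)⁻¹ ^ 2) *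
            Real.log (2 + (M.numPairs : ℝ) + ε⁻¹ + (1 - M.γ)⁻¹ + δ⁻¹) ^ k) ∧
        RealRAM.tapeMeasure {ω | ¬ ∃ (t : ℕ) (σ : RealRAM.State),
          RealRAM.Exec ω p (I.input ε δ) t σ ∧ I.IsEpsOptimalOutput ε σ} ≤ ENNReal.ofReal δ := by
  refine ⟨mainProg, 2 * 10 ^ 7, 3, fun S _ _ A _ _ M I ε δ hε hδ hδ1 => ?_⟩
  have hA : 0 < M.numPairs := Fintype.card_pos.trans_le M.numStates_le_numPairs
  obtain ⟨N, K, c, H⟩ := exists_isParam I.toTabular ε δ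
  obtain ⟨g, hg⟩ := exists_isLeast_le_two_pow (M.nnz : ℝ)
  have hc : 0 < c := H.logFactor_pos hA hδ hδ1
  have hrun := fun ω => runs_mainProg (ω := ω) (loaded_input I ε δ) rfl rfl H
    (by exact_mod_cast hg.1)
  refine ⟨fun ω => ?_, (measure_mono <| Set.ofPred_subset_ofPred.2 fun ω => mt fun hacc => ?_).trans
    (H.measure_not_estimatesAccurate_le hδ hc)⟩
  · obtain ⟨t, σ, hexec, ht, -⟩ := hrun ω
    exact ⟨t, σ, hexec, (Nat.cast_le.2 ht).trans (H.totalCost_le hg hA M.numStates_le_numPairs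
      M.nnz_le_numPairs_mul_numStates hε hδ)⟩
  · obtain ⟨t, σ, hexec, -, hv, hgreedy⟩ := hrun ω
    refine ⟨t, σ, hexec, isEpsOptimalOutput I hε.le (fun s hs => ?_) hgreedy⟩
    rw [hv s hs]
    exact H.abs_epochs_sub_le hε hc I.solvesBellman_tabulate_optValue
      (fun s _ => I.abs_tabulate_optValue_le s) hacc hs
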